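/- Let $\mathfrak g_2$ be the complex exceptional simple Lie algebra of type $G_2$. A $|3|$-grading of $\mathfrak g_2$ is a direct sum decomposition $\mathfrak n_{-3}\oplus\cdots\oplus\mathfrak n_{3}$ of $\mathfrak g_2$ into subspaces with $[\mathfrak n_i,\mathfrak n_j]\subseteq\mathfrak n_{i+j}$ (where $\mathfrak n_i=0$ for $|i|>3$), with $\mathfrak n_{-3}\neq 0$, and such that the subalgebra $\mathfrak n_{-3}\oplus\mathfrak n_{-2}\oplus\mathfrak n_{-1}$ is generated by $\mathfrak n_{-1}$. For an integer $r\ge 0$ let $\mathfrak F_{r,3}=\mathfrak f_{-3}\oplus\mathfrak f_{-2}\oplus\mathfrak f_{-1}$ be the free $3$-step nilpotent complex Lie algebra on $r$ generators with its canonical grading, $\mathfrak f_{-n}$ being spanned by the brackets of $n$ generators. A graded isomorphism is a Lie algebra isomorphism that maps each graded component onto the component of the same degree. The Cartan grading of $\mathfrak g_2$ is the one associated to $\Sigma=\{\alpha_1\}$, where $\alpha_1,\alpha_2$ are the simple roots and the highest root is $3\alpha_1+2\alpha_2$: its component of degree $i$ is the sum of the root spaces of the roots whose coefficient at $\alpha_1$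 is $i$, together with the Cartan subalgebra if $i=0$. **Theorem.** (1) Let $\mathfrak n_{-3}\oplus\cdots\oplus\mathfrak n_{3}$ be a $|3|$-grading of $\mathfrak g_2$ and suppose that there is a graded isomorphism between $\mathfrak F_{r,3}$ and $\mathfrak n_{-3}\oplus\mathfrak n_{-2}\oplus\mathfrak n_{-1}$. Then $2r^3+3r^2+r-30=0$ and hence $r=2$. Moreover, the grading is the Cartan grading up to an automorphism of $\mathfrak g_2$. (2) This case does occur: the Cartan grading is a $|3|$-grading of $\mathfrak g_2$, and there is a graded isomorphism between $\mathfrak F_{2,3}$ and its negative part. -/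

import Mathlib

namespace LieGrading

noncomputable section

section General

variable {R L M : Type*} [CommRing R] [LieRing L] [LieAlgebra R L] [LieRing M] [LieAlgebra R M]

/-- A `|k|`-grading `L = L₋ₖ ⊕ ⋯ ⊕ Lₖ` of a Lie algebra `L`, given as a family of subspaces indexed
by `ℤ` that vanishes outside `[-k, k]`: the sum is direct, `⁅Lᵢ, Lⱼ⁆ ⊆ Lᵢ₊ⱼ`, the component of degree
`-k` is nonzero, and the negative part is generated as a Lie algebra by the component of
degree `-1`. -/
structure IsKGrading (k : ℕ) (𝔫 : ℤ → Submodule R L) : Prop where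
  isInternal : DirectSum.IsInternal 𝔫
  gradedBracket : SetLike.GradedBracket 𝔫
  eq_bot : ∀ i : ℤ, (k : ℤ) < |i| → 𝔫 i = ⊥
  ne_bot : 𝔫 (-(k : ℤ)) ≠ ⊥
  generated : ∀ i : ℤ, i < 0 →
    𝔫 i ≤ (LieSubalgebra.lieSpan R L (𝔫 (-1) : Set L)).toSubmodule

/-- The negative part `L₋ₖ ⊕ ⋯ ⊕ L₋₁` of a `|k|`-grading, as a Lie subalgebra. -/
def negativePart {k : ℕ} {𝔫 : ℤ → Submodule R L} (h : IsKGrading k 𝔫) : LieSubalgebra R L where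
  toSubmodule := ⨆ i : {i : ℤ // i < 0}, 𝔫 i
  lie_mem' := by
    intro x y hx hy
    change x ∈ ⨆ i : {i : ℤ // i < 0}, 𝔫 i at hx
    change y ∈ ⨆ i : {i : ℤ // i < 0}, 𝔫 i at hy
    change ⁅x, y⁆ ∈ ⨆ i : {i : ℤ // i < 0}, 𝔫 i
    induction hx using Submodule.iSup_induction' with
    | mem i x hx =>
      induction hy using Submodule.iSup_induction' with
      | mem j y hy =>
        exact Submodule.mem_iSup_of_mem (⟨i + j, add_neg i.2 j.2⟩ : {i : ℤ // i < 0})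
          (h.gradedBracket.bracket_mem hx hy)
      | zero => simp
      | add y z _ _ hy hz => rw [lie_add]; exact add_mem hy hz
    | zero => simp
    | add x z _ _ hx hz => rw [add_lie]; exact add_mem hx hz

/-- The grading of the negative part induced by a `|k|`-grading. -/
def negativeGrading {k : ℕ} {𝔫 : ℤ → Submodule R L} (h : IsKGrading k 𝔫) :
    ℤ → Submodule R (negativePart h) :=
  fun i => if i < 0 then (𝔫 i).comap (negativePart h).toSubmodule.subtype else ⊥

/-- Existence of a graded isomorphism between two graded Lie algebras `(L, 𝔤)` and `(M, 𝔪)`. -/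
def GradedIsomorphic (𝔤 : ℤ → Submodule R L) (𝔪 : ℤ → Submodule R M) : Prop :=
  ∃ φ : L ≃ₗ⁅R⁆ M, ∀ i : ℤ, (𝔤 i).map (φ : L →ₗ[R] M) = 𝔪 i

end General

section Free

variable (R : Type*) [CommRing R]

/-- The free `k`-step nilpotent Lie algebra `𝔉_{r,k}` on `r` generators: the quotient of the free
Lie algebra by the ideal spanned by all brackets of more than `k` elements. (In Mathlib the
`k`-th term of the lower central series is spanned by brackets of `k + 1` elements.) -/
abbrev FreeNilpotent (r k : ℕ) : Type _ :=
  FreeLieAlgebra R (Fin r) ⧸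
    LieModule.lowerCentralSeries R (FreeLieAlgebra R (Fin r)) (FreeLieAlgebra R (Fin r)) k

/-- The generators of `𝔉_{r,k}`. -/
def freeNilpotentGen (r k : ℕ) (j : Fin r) : FreeNilpotent R r k :=
  LieSubmodule.Quotient.mk (FreeLieAlgebra.of R j)

/-- The span in `𝔉_{r,k}` of the iterated brackets `⁅x₁, ⁅x₂, ⋯⁆⁆` of exactly `n` generators. -/
def freeNilpotentDegree (r k : ℕ) : ℕ → Submodule R (FreeNilpotent R r k)
  | 0 => ⊥
  | 1 => Submodule.span R (Set.range (freeNilpotentGen R r k))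
  | n + 2 => Submodule.span R
      {z | ∃ j : Fin r, ∃ y ∈ freeNilpotentDegree r k (n + 1), z = ⁅freeNilpotentGen R r k j, y⁆}

/-- The canonical grading `𝔉_{r,k} = 𝔣₋ₖ ⊕ ⋯ ⊕ 𝔣₋₁`. -/
def freeNilpotentGrading (r k : ℕ) : ℤ → Submodule R (FreeNilpotent R r k) :=
  fun i => freeNilpotentDegree R r k (-i).toNat

end Free

section Serre

variable (R : Type*) [CommRing R] {B : Type*} [Fintype B] [DecidableEq B] (CM : Matrix B B ℤ)

/-- The Cartan generator `Hᵢ` (simple coroot) of the Lie algebra of a Cartan matrix. -/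
def serreH (i : B) : CM.ToLieAlgebra R :=
  (LieSubmodule.Quotient.mk (FreeLieAlgebra.of R (CartanMatrix.Generators.H i)) :
    FreeLieAlgebra R (CartanMatrix.Generators B) ⧸ CartanMatrix.Relations.toIdeal R CM)

/-- The root space of `α = ∑ⱼ aⱼ αⱼ`, where `αⱼ` are the simple roots: all `x` with
`⁅Hᵢ, x⁆ = α(Hᵢ) x` for all `i`, where `αⱼ(Hᵢ)` is the Cartan matrix entry `CM i j`. For `a = 0` this
is the Cartan subalgebra, and if `α` is neither `0` nor a root it is zero. -/
def serreRootSpace (a : B → ℤ) : Submodule R (CM.ToLieAlgebra R) :=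
  ⨅ i : B, (LieAlgebra.ad R (CM.ToLieAlgebra R) (serreH R CM i)).eigenspace
    ((∑ j, a j * CM i j : ℤ) : R)

/-- The grading associated to a set `S` of simple roots: the component of degree `i` is the sum of
the root spaces of all `α` whose height `∑_{j ∈ S} aⱼ` with respect to `S` equals `i` (including the
Cartan subalgebra for `i = 0`). -/
def heightGrading (S : Finset B) (i : ℤ) : Submodule R (CM.ToLieAlgebra R) :=
  ⨆ a : {a : B → ℤ // ∑ j ∈ S, a j = i}, serreRootSpace R CM a

end Serre

/-- The Cartan grading of `𝔤₂`: the grading associated to `{α₁}`, where `α₁` is the short simple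
root (the highest root is `3 α₁ + 2 α₂`). With the convention `⁅Hᵢ, Eⱼ⁆ = CM i j • Eⱼ` and the matrix
`CartanMatrix.G₂ = !![2, -3; -1, 2]`, the short simple root has index `0`. -/
def cartanGrading : ℤ → Submodule ℂ (LieAlgebra.g₂ ℂ) :=
  heightGrading ℂ CartanMatrix.G₂ {0}

end

end LieGrading

/-! The Serre presentation does two jobs. It makes 𝔤₂ explicit: the relations show that fourteen
root vectors and coroots span, and a seven-dimensional representation shows that the presentation
does not collapse. This gives a basis, hence dimension 14 and simplicity (`g₂_eq_bot_or_eq_top`). It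
also turns Serre generators found inside 𝔤₂ into an endomorphism (`SerreG2.exists_lift`), which
simplicity and finite dimension make an automorphism. Uniqueness of the grading thus reduces to
finding Serre generators whose short simple root vectors have degree ±1 and whose long ones have
degree 0.

For any |3|-grading of 𝔤₂ the Killing form pairs `𝔫 i` perfectly with `𝔫 (-i)`, so the negative part
has dimension at most 7. Three free generators would already contribute 3 + 3 + 2 = 8, and a single
generator gives nothing in degree -3; hence r = 2 (`rank_eq_two`).

The negative dimensions are then 2, 1, 2, which leaves 14 - 10 = 4 for `𝔫 0`. By simplicity and the
Killing form `𝔫 0` acts faithfully on `𝔫 (-1)` (`eq_zero_of_lie_eq_zero`), so it is all of 𝔤𝔩(`𝔫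
(-1)`). Applying an element of degree 1 to the vanishing brackets of degree -4 determines its action
up to two parameters (`IsFreePair.exists_coeff_one`). A suitable choice of these completes a free
generator to an 𝔰𝔩₂, and the elementary matrices in `𝔫 0` supply the long root
(`IsFreePair.exists_serreG2`).

For existence, the Cartan grading is the eigenspace decomposition of one Cartan element. Its
negative part and the free algebra on two generators both have the five basic brackets as a basis.
-/

namespace LieGrading

/-! ### Generating sets of Lie algebras -/

section General

variable {R L : Type*} [CommRing R] [LieRing L] [LieAlgebra R L]

/-- A subspace that contains a generating set and is stable under bracketing with the generators is
everything. -/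
theorem eq_top_of_lie_stable {G : Set L} (hG : LieSubalgebra.lieSpan R L G = ⊤)
    (S : Submodule R L) (hGS : G ⊆ S) (hS : ∀ g ∈ G, ∀ s ∈ S, ⁅g, s⁆ ∈ S) : S = ⊤ := by
  have key : ∀ x : L, ∀ s ∈ S, ⁅x, s⁆ ∈ S := by
    intro x
    have hx : x ∈ LieSubalgebra.lieSpan R L G := by rw [hG]; trivial
    induction hx using LieSubalgebra.lieSpan_induction with
    | mem x h => exact hS x h
    | zero => intro s _; simp
    | add x y _ _ h1 h2 => intro s hs; rw [add_lie]; exact add_mem (h1 s hs) (h2 s hs)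
    | smul a x _ h => intro s hs; rw [smul_lie]; exact S.smul_mem _ (h s hs)
    | lie x y _ _ h1 h2 =>
      intro s hs
      rw [lie_lie]
      exact sub_mem (h1 _ (h2 s hs)) (h2 _ (h1 s hs))
  rw [eq_top_iff]
  intro x _
  have hx : x ∈ LieSubalgebra.lieSpan R L G := by rw [hG]; trivial
  induction hx using LieSubalgebra.lieSpan_induction with
  | mem x h => exact hGS h
  | zero => exact zero_mem _
  | add x y _ _ h1 h2 => exact add_mem (h1 trivial) (h2 trivial)
  | smul a x _ h => exact S.smul_mem _ (h trivial)
  | lie x y _ _ h1 h2 => exact key _ _ (h2 trivial)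

theorem lie_eq_smul_of_lie_eq_smul {h x y : L} {p q : R} (hx : ⁅h, x⁆ = p • x)
    (hy : ⁅h, y⁆ = q • y) : ⁅h, ⁅x, y⁆⁆ = (p + q) • ⁅x, y⁆ := by
  rw [leibniz_lie, hx, hy, smul_lie, lie_smul, add_smul]

/-- The universal property maps the free algebra into the subalgebra spanned by its generators;
followed by the inclusion this fixes the generators, so it is the identity. -/
theorem lieSpan_freeLieAlgebra (X : Type*) :
    LieSubalgebra.lieSpan R (FreeLieAlgebra R X) (Set.range (FreeLieAlgebra.of R)) = ⊤ := by
  set K := LieSubalgebra.lieSpan R (FreeLieAlgebra R X) (Set.range (FreeLieAlgebra.of R)) with hK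
  let φ : FreeLieAlgebra R X →ₗ⁅R⁆ K :=
    FreeLieAlgebra.lift R fun x => ⟨FreeLieAlgebra.of R x, LieSubalgebra.subset_lieSpan ⟨x, rfl⟩⟩
  have h : K.incl.comp φ = LieHom.id := by
    ext x
    simp [φ]
  rw [eq_top_iff]
  intro x _
  have := DFunLike.congr_fun h x
  simp only [LieHom.comp_apply, LieHom.id_apply] at this
  rw [← this]
  exact (φ x).2

theorem lieSpan_range_eq_top_of_surjective {X : Type*}
    (φ : FreeLieAlgebra R X →ₗ⁅R⁆ L) (hφ : Function.Surjective φ) :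
    LieSubalgebra.lieSpan R L (Set.range fun x => φ (FreeLieAlgebra.of R x)) = ⊤ := by
  rw [eq_top_iff]
  intro y _
  obtain ⟨x, rfl⟩ := hφ y
  have hx : x ∈ LieSubalgebra.lieSpan R (FreeLieAlgebra R X) (Set.range (FreeLieAlgebra.of R)) := by
    rw [lieSpan_freeLieAlgebra]; trivial
  induction hx using LieSubalgebra.lieSpan_induction with
  | mem x h => obtain ⟨i, rfl⟩ := h; exact LieSubalgebra.subset_lieSpan ⟨i, rfl⟩
  | zero => rw [map_zero]; exact zero_mem _
  | add x y _ _ h1 h2 => rw [map_add]; exact add_mem (h1 trivial) (h2 trivial)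
  | smul a x _ h => rw [map_smul]; exact LieSubalgebra.smul_mem _ _ (h trivial)
  | lie x y _ _ h1 h2 =>
    rw [LieHom.map_lie]; exact LieSubalgebra.lie_mem _ (h1 trivial) (h2 trivial)

end General

/-! ### Consequences of the Serre relations of type G₂ -/

/-- The Serre relations of type `G₂` for elements of a complex Lie algebra. -/
structure SerreG2 {M : Type*} [LieRing M] [LieAlgebra ℂ M] (e₀ e₁ f₀ f₁ h₀ h₁ : M) : Prop where
  hh : ⁅h₀, h₁⁆ = 0
  ef00 : ⁅e₀, f₀⁆ = h₀
  ef11 : ⁅e₁, f₁⁆ = h₁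
  ef01 : ⁅e₀, f₁⁆ = 0
  ef10 : ⁅e₁, f₀⁆ = 0
  he00 : ⁅h₀, e₀⁆ = (2 : ℂ) • e₀
  he01 : ⁅h₀, e₁⁆ = (-3 : ℂ) • e₁
  he10 : ⁅h₁, e₀⁆ = (-1 : ℂ) • e₀
  he11 : ⁅h₁, e₁⁆ = (2 : ℂ) • e₁
  hf00 : ⁅h₀, f₀⁆ = (-2 : ℂ) • f₀
  hf01 : ⁅h₀, f₁⁆ = (3 : ℂ) • f₁
  hf10 : ⁅h₁, f₀⁆ = (1 : ℂ) • f₀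
  hf11 : ⁅h₁, f₁⁆ = (-2 : ℂ) • f₁
  e01 : ⁅e₀, ⁅e₀, ⁅e₀, ⁅e₀, e₁⁆⁆⁆⁆ = 0
  e10 : ⁅e₁, ⁅e₁, e₀⁆⁆ = 0
  f01 : ⁅f₀, ⁅f₀, ⁅f₀, ⁅f₀, f₁⁆⁆⁆⁆ = 0
  f10 : ⁅f₁, ⁅f₁, f₀⁆⁆ = 0

namespace SerreG2

variable {M : Type*} [LieRing M] [LieAlgebra ℂ M] {e₀ e₁ f₀ f₁ h₀ h₁ : M}

/-- The Chevalley involution: it transfers every computation with positive roots to negative ones.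
-/
theorem symm (S : SerreG2 e₀ e₁ f₀ f₁ h₀ h₁) : SerreG2 f₀ f₁ e₀ e₁ (-h₀) (-h₁) where
  hh := by simp [S.hh]
  ef00 := by rw [← lie_skew, S.ef00]
  ef11 := by rw [← lie_skew, S.ef11]
  ef01 := by rw [← lie_skew, S.ef10, neg_zero]
  ef10 := by rw [← lie_skew, S.ef01, neg_zero]
  he00 := by rw [neg_lie, S.hf00]; module
  he01 := by rw [neg_lie, S.hf01]; module
  he10 := by rw [neg_lie, S.hf10]; module
  he11 := by rw [neg_lie, S.hf11]; module
  hf00 := by rw [neg_lie, S.he00]; module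
  hf01 := by rw [neg_lie, S.he01]; module
  hf10 := by rw [neg_lie, S.he10]; module
  hf11 := by rw [neg_lie, S.he11]; module
  e01 := S.f01
  e10 := S.f10
  f01 := S.e01
  f10 := S.e10

/-- The positive root vectors generated by two simple root vectors of type `G₂`. -/
def rootVec (x y : M) : Fin 6 → M :=
  ![x, y, ⁅x, y⁆, ⁅x, ⁅x, y⁆⁆, ⁅x, ⁅x, ⁅x, y⁆⁆⁆, ⁅y, ⁅x, ⁅x, ⁅x, y⁆⁆⁆⁆]

/-- The coefficients at the short simple root of the positive roots of type `G₂`. -/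
def coeffShort : Fin 6 → ℤ := ![1, 0, 1, 2, 3, 3]

/-- The coefficients at the long simple root of the positive roots of type `G₂`. -/
def coeffLong : Fin 6 → ℤ := ![0, 1, 1, 1, 1, 2]

theorem lie_rootVec {h x y : M} {p q : ℂ} (hx : ⁅h, x⁆ = p • x) (hy : ⁅h, y⁆ = q • y) (i : Fin 6) :
    ⁅h, rootVec x y i⁆ = ((coeffShort i : ℂ) * p + (coeffLong i : ℂ) * q) • rootVec x y i := by
  have h2 := lie_eq_smul_of_lie_eq_smul hx hy
  have h3 := lie_eq_smul_of_lie_eq_smul hx h2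
  have h4 := lie_eq_smul_of_lie_eq_smul hx h3
  have h5 := lie_eq_smul_of_lie_eq_smul hy h4
  fin_cases i
  · simp [rootVec, coeffShort, coeffLong, hx]
  · simp [rootVec, coeffShort, coeffLong, hy]
  · simp [rootVec, coeffShort, coeffLong, h2]
  · simp only [rootVec, coeffShort, coeffLong]
    refine h3.trans ?_
    congr 1
    push_cast
    norm_num
    ring
  · refine h4.trans ?_
    congr 1
    norm_num [coeffShort, coeffLong]
    ring
  · refine h5.trans ?_
    congr 1
    norm_num [coeffShort, coeffLong]
    ring

variable (S : SerreG2 e₀ e₁ f₀ f₁ h₀ h₁)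
include S

/-- In the names below, a = ⁅e₀, e₁⁆, b = ⁅e₀, a⁆, c = ⁅e₀, b⁆ and d = ⁅e₁, c⁆ are the non-simple
positive root vectors. -/
theorem e₁_a : ⁅e₁, ⁅e₀, e₁⁆⁆ = 0 := by
  rw [← lie_skew e₀ e₁, lie_neg, S.e10, neg_zero]

theorem e₁_b : ⁅e₁, ⁅e₀, ⁅e₀, e₁⁆⁆⁆ = 0 := by
  rw [leibniz_lie, S.e₁_a, ← lie_skew e₁ e₀, neg_lie, lie_self]
  simp

theorem a_b : ⁅⁅e₀, e₁⁆, ⁅e₀, ⁅e₀, e₁⁆⁆⁆ = -⁅e₁, ⁅e₀, ⁅e₀, ⁅e₀, e₁⁆⁆⁆⁆ := by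
  rw [leibniz_lie e₁ e₀, S.e₁_b, lie_zero, add_zero, ← lie_skew e₁ e₀, neg_lie, neg_neg]

theorem e₁_d : ⁅e₁, ⁅e₁, ⁅e₀, ⁅e₀, ⁅e₀, e₁⁆⁆⁆⁆⁆ = 0 := by
  rw [← neg_eq_zero, ← lie_neg, ← S.a_b, leibniz_lie, S.e₁_a, S.e₁_b]
  simp

/-- Expanding d = ⁅e₁, c⁆ gives ⁅e₀, d⁆ = ⁅a, c⁆, while expanding d = -⁅a, b⁆ gives ⁅e₀, d⁆ = -⁅a,
c⁆. -/
theorem e₀_d : ⁅e₀, ⁅e₁, ⁅e₀, ⁅e₀, ⁅e₀, e₁⁆⁆⁆⁆⁆ = 0 := by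
  have h1 : ⁅e₀, ⁅e₁, ⁅e₀, ⁅e₀, ⁅e₀, e₁⁆⁆⁆⁆⁆ = ⁅⁅e₀, e₁⁆, ⁅e₀, ⁅e₀, ⁅e₀, e₁⁆⁆⁆⁆ := by
    rw [leibniz_lie e₀ e₁, S.e01, lie_zero, add_zero]
  have h2 : -⁅e₀, ⁅e₁, ⁅e₀, ⁅e₀, ⁅e₀, e₁⁆⁆⁆⁆⁆ = ⁅⁅e₀, e₁⁆, ⁅e₀, ⁅e₀, ⁅e₀, e₁⁆⁆⁆⁆ := by
    rw [← lie_neg, ← S.a_b, leibniz_lie e₀, lie_self, zero_add]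
  have h3 : (2 : ℂ) • ⁅e₀, ⁅e₁, ⁅e₀, ⁅e₀, ⁅e₀, e₁⁆⁆⁆⁆⁆ = 0 := by
    rw [two_smul]
    nth_rewrite 2 [h1]
    rw [← h2, add_neg_cancel]
  exact (smul_eq_zero.mp h3).resolve_left two_ne_zero

theorem f₀_e₀ : ⁅f₀, e₀⁆ = -h₀ := S.symm.ef00
theorem f₀_e₁ : ⁅f₀, e₁⁆ = 0 := S.symm.ef01
theorem f₁_e₀ : ⁅f₁, e₀⁆ = 0 := S.symm.ef10
theorem f₁_e₁ : ⁅f₁, e₁⁆ = -h₁ := S.symm.ef11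

theorem h₀_rootVec (i : Fin 6) :
    ⁅h₀, rootVec e₀ e₁ i⁆ = (2 * coeffShort i - 3 * coeffLong i : ℂ) • rootVec e₀ e₁ i := by
  rw [lie_rootVec S.he00 S.he01]
  congr 1
  ring

theorem h₁_rootVec (i : Fin 6) :
    ⁅h₁, rootVec e₀ e₁ i⁆ = (- coeffShort i + 2 * coeffLong i : ℂ) • rootVec e₀ e₁ i := by
  rw [lie_rootVec S.he10 S.he11]
  congr 1
  ring

/-- For the 𝔰𝔩₂ of e₀, h₀, f₀ the vector e₁ has lowest weight -3, so f₀ descends the string e₁, a,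
b, c with factors n(4 - n) = 3, 4, 3. -/
theorem f₀_a : ⁅f₀, ⁅e₀, e₁⁆⁆ = (3 : ℂ) • e₁ := by
  rw [leibniz_lie, S.f₀_e₀, S.f₀_e₁, neg_lie, S.he01]
  simp

theorem f₀_b : ⁅f₀, ⁅e₀, ⁅e₀, e₁⁆⁆⁆ = (4 : ℂ) • ⁅e₀, e₁⁆ := by
  have h := S.h₀_rootVec 2
  simp only [rootVec, coeffShort, coeffLong, Fin.isValue, Matrix.cons_val] at h
  rw [leibniz_lie, S.f₀_e₀, S.f₀_a, neg_lie, h, lie_smul]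
  push_cast
  module

theorem f₀_c : ⁅f₀, ⁅e₀, ⁅e₀, ⁅e₀, e₁⁆⁆⁆⁆ = (3 : ℂ) • ⁅e₀, ⁅e₀, e₁⁆⁆ := by
  have h := S.h₀_rootVec 3
  simp only [rootVec, coeffShort, coeffLong, Fin.isValue, Matrix.cons_val] at h
  rw [leibniz_lie, S.f₀_e₀, S.f₀_b, neg_lie, h, lie_smul]
  push_cast
  module

theorem f₀_d : ⁅f₀, ⁅e₁, ⁅e₀, ⁅e₀, ⁅e₀, e₁⁆⁆⁆⁆⁆ = 0 := by
  rw [leibniz_lie, S.f₀_e₁, S.f₀_c, lie_smul, S.e₁_b]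
  simp

theorem f₁_a : ⁅f₁, ⁅e₀, e₁⁆⁆ = -e₀ := by
  rw [leibniz_lie, S.f₁_e₀, S.f₁_e₁, zero_lie, zero_add, lie_neg, lie_skew, S.he10]
  simp

theorem f₁_b : ⁅f₁, ⁅e₀, ⁅e₀, e₁⁆⁆⁆ = 0 := by
  rw [leibniz_lie, S.f₁_e₀, S.f₁_a]
  simp

theorem f₁_c : ⁅f₁, ⁅e₀, ⁅e₀, ⁅e₀, e₁⁆⁆⁆⁆ = 0 := by
  rw [leibniz_lie, S.f₁_e₀, S.f₁_b]
  simp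

theorem f₁_d : ⁅f₁, ⁅e₁, ⁅e₀, ⁅e₀, ⁅e₀, e₁⁆⁆⁆⁆⁆ = ⁅e₀, ⁅e₀, ⁅e₀, e₁⁆⁆⁆ := by
  have h := S.h₁_rootVec 4
  simp only [rootVec, coeffShort, coeffLong, Fin.isValue, Matrix.cons_val] at h
  rw [leibniz_lie, S.f₁_e₁, S.f₁_c, neg_lie, h, lie_zero]
  push_cast
  module

/-- The span of the root vectors and of the Cartan elements is stable under `e₀`, `e₁`, `f₀`, `f₁`.
-/
theorem lie_mem_span {T : Submodule ℂ M} (hp : ∀ i, rootVec e₀ e₁ i ∈ T) (h0 : h₀ ∈ T)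
    (h1 : h₁ ∈ T) (i : Fin 6) :
    ⁅e₀, rootVec e₀ e₁ i⁆ ∈ T ∧ ⁅e₁, rootVec e₀ e₁ i⁆ ∈ T ∧
      ⁅f₀, rootVec e₀ e₁ i⁆ ∈ T ∧ ⁅f₁, rootVec e₀ e₁ i⁆ ∈ T := by
  have p0 : e₀ ∈ T := hp 0
  have p1 : e₁ ∈ T := hp 1
  have p2 : ⁅e₀, e₁⁆ ∈ T := hp 2
  have p3 : ⁅e₀, ⁅e₀, e₁⁆⁆ ∈ T := hp 3
  have p4 : ⁅e₀, ⁅e₀, ⁅e₀, e₁⁆⁆⁆ ∈ T := hp 4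
  have p5 : ⁅e₁, ⁅e₀, ⁅e₀, ⁅e₀, e₁⁆⁆⁆⁆ ∈ T := hp 5
  have p2' : ⁅e₁, e₀⁆ ∈ T := by rw [← lie_skew]; exact neg_mem p2
  fin_cases i
  · simp [rootVec, p2', S.f₀_e₀, S.f₁_e₀, h0]
  · simp [rootVec, p2, S.f₀_e₁, S.f₁_e₁, h1]
  · simp [rootVec, p3, S.f₀_a, S.f₁_a, S.e₁_a, p0, T.smul_mem _ p1]
  · simp [rootVec, p4, S.f₀_b, S.f₁_b, S.e₁_b, T.smul_mem _ p2]
  · simp [rootVec, p5, S.f₀_c, S.f₁_c, S.e01, T.smul_mem _ p3]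
  · simp [rootVec, S.f₀_d, S.f₁_d, S.e₀_d, S.e₁_d, p4]

/-- An ideal that contains one of the positive root vectors contains a Cartan element. -/
theorem h_mem_of_rootVec_mem {I : LieIdeal ℂ M} {i : Fin 6} (hi : rootVec e₀ e₁ i ∈ I) :
    h₀ ∈ I ∨ h₁ ∈ I := by
  have k0 : e₀ ∈ I → h₀ ∈ I ∨ h₁ ∈ I := fun h => by
    left; rw [← neg_mem_iff (x := h₀), ← S.f₀_e₀]; exact lie_mem_right ℂ M I _ _ h
  have k1 : e₁ ∈ I → h₀ ∈ I ∨ h₁ ∈ I := fun h => by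
    right; rw [← neg_mem_iff (x := h₁), ← S.f₁_e₁]; exact lie_mem_right ℂ M I _ _ h
  have k2 : ⁅e₀, e₁⁆ ∈ I → h₀ ∈ I ∨ h₁ ∈ I := fun h => by
    apply k0; rw [← neg_mem_iff, ← S.f₁_a]; exact lie_mem_right ℂ M I _ _ h
  have k3 : ⁅e₀, ⁅e₀, e₁⁆⁆ ∈ I → h₀ ∈ I ∨ h₁ ∈ I := fun h => by
    apply k2
    have := lie_mem_right ℂ M I f₀ _ h
    rw [S.f₀_b] at this
    exact (I.toSubmodule.smul_mem_iff (by norm_num)).mp this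
  have k4 : ⁅e₀, ⁅e₀, ⁅e₀, e₁⁆⁆⁆ ∈ I → h₀ ∈ I ∨ h₁ ∈ I := fun h => by
    apply k3
    have := lie_mem_right ℂ M I f₀ _ h
    rw [S.f₀_c] at this
    exact (I.toSubmodule.smul_mem_iff (by norm_num)).mp this
  have k5 : ⁅e₁, ⁅e₀, ⁅e₀, ⁅e₀, e₁⁆⁆⁆⁆ ∈ I → h₀ ∈ I ∨ h₁ ∈ I := fun h => by
    apply k4; rw [← S.f₁_d]; exact lie_mem_right ℂ M I _ _ h
  fin_cases i
  exacts [k0 hi, k1 hi, k2 hi, k3 hi, k4 hi, k5 hi]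

/-- An ideal that contains one of the Cartan elements contains the simple root vectors. -/
theorem e_mem_of_h_mem {I : LieIdeal ℂ M} (h : h₀ ∈ I ∨ h₁ ∈ I) : e₀ ∈ I ∧ e₁ ∈ I := by
  rcases h with h | h
  · have a := lie_mem_left ℂ M I _ e₀ h
    have b := lie_mem_left ℂ M I _ e₁ h
    rw [S.he00] at a
    rw [S.he01] at b
    exact ⟨(I.toSubmodule.smul_mem_iff (by norm_num)).mp a,
      (I.toSubmodule.smul_mem_iff (by norm_num)).mp b⟩
  · have a := lie_mem_left ℂ M I _ e₀ h
    have b := lie_mem_left ℂ M I _ e₁ h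
    rw [S.he10] at a
    rw [S.he11] at b
    exact ⟨(I.toSubmodule.smul_mem_iff (by norm_num)).mp a,
      (I.toSubmodule.smul_mem_iff (by norm_num)).mp b⟩

end SerreG2

noncomputable section

/-! ### The presentation of 𝔤₂ and its universal property -/

section QuotientLift

variable {R L M : Type*} [CommRing R] [LieRing L] [LieAlgebra R L] [LieRing M] [LieAlgebra R M]

/-- The projection onto the quotient by an ideal, as a homomorphism of Lie algebras. -/
def quotientMk (I : LieIdeal R L) : L →ₗ⁅R⁆ L ⧸ I :=
  { I.toSubmodule.mkQ with map_lie' := fun {_ _} => rfl }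

theorem quotientMk_surjective (I : LieIdeal R L) : Function.Surjective (quotientMk I) :=
  I.toSubmodule.mkQ_surjective

theorem quotientMk_eq_zero {I : LieIdeal R L} {x : L} : quotientMk I x = 0 ↔ x ∈ I :=
  LieSubmodule.Quotient.mk_eq_zero'

/-- A homomorphism of Lie algebras that vanishes on an ideal descends to the quotient. -/
def quotientLift (I : LieIdeal R L) (φ : L →ₗ⁅R⁆ M) (h : ∀ x ∈ I, φ x = 0) : L ⧸ I →ₗ⁅R⁆ M :=
  { I.toSubmodule.liftQ (φ : L →ₗ[R] M) h with
    map_lie' := by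
      intro x y
      obtain ⟨x, rfl⟩ := quotientMk_surjective I x
      obtain ⟨y, rfl⟩ := quotientMk_surjective I y
      exact φ.map_lie x y }

end QuotientLift

open CartanMatrix CartanMatrix.Relations

/-- The projection of the free Lie algebra onto `𝔤₂`. -/
def g₂Mk : FreeLieAlgebra ℂ (Generators (Fin 2)) →ₗ⁅ℂ⁆ LieAlgebra.g₂ ℂ :=
  quotientMk (Relations.toIdeal ℂ CartanMatrix.G₂)

theorem g₂Mk_surjective : Function.Surjective g₂Mk := quotientMk_surjective _

theorem g₂Mk_eq_zero {x : FreeLieAlgebra ℂ (Generators (Fin 2))}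
    (hx : x ∈ Relations.toSet ℂ CartanMatrix.G₂) : g₂Mk x = 0 :=
  quotientMk_eq_zero.mpr (LieSubmodule.subset_lieSpan hx)

/-- The generators `Eᵢ` of `𝔤₂`. -/
def gE (i : Fin 2) : LieAlgebra.g₂ ℂ := g₂Mk (FreeLieAlgebra.of ℂ (Generators.E i))

/-- The generators `Fᵢ` of `𝔤₂`. -/
def gF (i : Fin 2) : LieAlgebra.g₂ ℂ := g₂Mk (FreeLieAlgebra.of ℂ (Generators.F i))

/-- The generators `Hᵢ` of `𝔤₂`. -/
def gH (i : Fin 2) : LieAlgebra.g₂ ℂ := g₂Mk (FreeLieAlgebra.of ℂ (Generators.H i))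

theorem serreH_eq_gH (i : Fin 2) : serreH ℂ CartanMatrix.G₂ i = gH i := rfl

theorem gH_gH (i j : Fin 2) : ⁅gH i, gH j⁆ = 0 := by
  have h : HH ℂ (i, j) ∈ Relations.toSet ℂ CartanMatrix.G₂ := by simp [Relations.toSet]
  simpa [HH, gH] using g₂Mk_eq_zero h

theorem gE_gF (i j : Fin 2) : ⁅gE i, gF j⁆ = if i = j then gH i else 0 := by
  have h : EF ℂ (i, j) ∈ Relations.toSet ℂ CartanMatrix.G₂ := by simp [Relations.toSet]
  have := g₂Mk_eq_zero h
  split_ifs with hij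
  · subst hij
    simpa [gE, gF, gH, EF, sub_eq_zero] using this
  · simpa [gE, gF, gH, EF, hij] using this

theorem gH_gE (i j : Fin 2) : ⁅gH i, gE j⁆ = CartanMatrix.G₂ i j • gE j := by
  have h : HE ℂ CartanMatrix.G₂ (i, j) ∈ Relations.toSet ℂ CartanMatrix.G₂ := by
    simp [Relations.toSet]
  have := g₂Mk_eq_zero h
  simp only [HE, Function.uncurry_apply_pair, map_sub, LieHom.map_lie, sub_eq_zero,
    map_zsmul] at this
  exact this

theorem gH_gF (i j : Fin 2) : ⁅gH i, gF j⁆ = -(CartanMatrix.G₂ i j • gF j) := by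
  have h : HF ℂ CartanMatrix.G₂ (i, j) ∈ Relations.toSet ℂ CartanMatrix.G₂ := by
    simp [Relations.toSet]
  have := g₂Mk_eq_zero h
  simp only [HF, Function.uncurry_apply_pair, map_add, LieHom.map_lie, map_zsmul] at this
  exact eq_neg_of_add_eq_zero_left this

theorem serreG2_g : SerreG2 (gE 0) (gE 1) (gF 0) (gF 1) (gH 0) (gH 1) where
  hh := gH_gH 0 1
  ef00 := gE_gF 0 0
  ef11 := gE_gF 1 1
  ef01 := gE_gF 0 1
  ef10 := gE_gF 1 0
  he00 := by rw [gH_gE, ← Int.cast_smul_eq_zsmul ℂ]; simp [CartanMatrix.G₂]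
  he01 := by rw [gH_gE, ← Int.cast_smul_eq_zsmul ℂ]; simp [CartanMatrix.G₂]
  he10 := by rw [gH_gE, ← Int.cast_smul_eq_zsmul ℂ]; simp [CartanMatrix.G₂]
  he11 := by rw [gH_gE, ← Int.cast_smul_eq_zsmul ℂ]; simp [CartanMatrix.G₂]
  hf00 := by rw [gH_gF, ← Int.cast_smul_eq_zsmul ℂ]; simp [CartanMatrix.G₂]
  hf01 := by rw [gH_gF, ← Int.cast_smul_eq_zsmul ℂ]; simp [CartanMatrix.G₂]
  hf10 := by rw [gH_gF, ← Int.cast_smul_eq_zsmul ℂ]; simp [CartanMatrix.G₂]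
  hf11 := by rw [gH_gF, ← Int.cast_smul_eq_zsmul ℂ]; simp [CartanMatrix.G₂]
  e01 := by
    have h : adE ℂ CartanMatrix.G₂ (0, 1) ∈ Relations.toSet ℂ CartanMatrix.G₂ := by
      simp [Relations.toSet]
    -- `adE` applies the power -a₀₁ = 3 of ad E₀ to ⁅E₀, E₁⁆, hence four factors E₀ in total.
    have h3 : (3 : ℤ).toNat = 3 := rfl
    simpa [gE, adE, CartanMatrix.G₂, h3, pow_succ] using g₂Mk_eq_zero h
  e10 := by
    have h : adE ℂ CartanMatrix.G₂ (1, 0) ∈ Relations.toSet ℂ CartanMatrix.G₂ := by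
      simp [Relations.toSet]
    simpa [gE, adE, CartanMatrix.G₂] using g₂Mk_eq_zero h
  f01 := by
    have h : adF ℂ CartanMatrix.G₂ (0, 1) ∈ Relations.toSet ℂ CartanMatrix.G₂ := by
      simp [Relations.toSet]
    have h3 : (3 : ℤ).toNat = 3 := rfl
    simpa [gF, adF, CartanMatrix.G₂, h3, pow_succ] using g₂Mk_eq_zero h
  f10 := by
    have h : adF ℂ CartanMatrix.G₂ (1, 0) ∈ Relations.toSet ℂ CartanMatrix.G₂ := by
      simp [Relations.toSet]
    simpa [gF, adF, CartanMatrix.G₂] using g₂Mk_eq_zero h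

/-- The universal property of `𝔤₂`: elements that satisfy the Serre relations define a
homomorphism. -/
theorem SerreG2.exists_lift {M : Type*} [LieRing M] [LieAlgebra ℂ M] {e₀ e₁ f₀ f₁ h₀ h₁ : M}
    (S : SerreG2 e₀ e₁ f₀ f₁ h₀ h₁) :
    ∃ φ : LieAlgebra.g₂ ℂ →ₗ⁅ℂ⁆ M, φ (gE 0) = e₀ ∧ φ (gE 1) = e₁ ∧ φ (gF 0) = f₀ ∧
      φ (gF 1) = f₁ ∧ φ (gH 0) = h₀ ∧ φ (gH 1) = h₁ := by
  let g : Generators (Fin 2) → M := fun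
    | .H i => ![h₀, h₁] i
    | .E i => ![e₀, e₁] i
    | .F i => ![f₀, f₁] i
  let ψ : FreeLieAlgebra ℂ (Generators (Fin 2)) →ₗ⁅ℂ⁆ M := FreeLieAlgebra.lift ℂ g
  have hof : ∀ x, ψ (FreeLieAlgebra.of ℂ x) = g x := fun x => FreeLieAlgebra.lift_of_apply g x
  have hker : Relations.toIdeal ℂ CartanMatrix.G₂ ≤ ψ.ker := by
    rw [Relations.toIdeal, LieSubmodule.lieSpan_le]
    have h1 : (1 : ℤ).toNat = 1 := rfl
    have h3 : (3 : ℤ).toNat = 3 := rfl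
    have hz : ∀ (n : ℤ) (x : M), n • x = (n : ℂ) • x := fun n x =>
      (Int.cast_smul_eq_zsmul ℂ n x).symm
    have hw : ∀ (n : ℤ) (x : FreeLieAlgebra ℂ (Generators (Fin 2))), n • x = (n : ℂ) • x :=
      fun n x => (Int.cast_smul_eq_zsmul ℂ n x).symm
    rintro x (((((⟨⟨i, j⟩, rfl⟩ | ⟨⟨i, j⟩, rfl⟩) | ⟨⟨i, j⟩, rfl⟩) | ⟨⟨i, j⟩, rfl⟩) |
      ⟨⟨i, j⟩, rfl⟩) | ⟨⟨i, j⟩, rfl⟩) <;> rw [SetLike.mem_coe, LieHom.mem_ker]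
    · have := S.hh
      have h' : ⁅h₁, h₀⁆ = 0 := by rw [← lie_skew, this, neg_zero]
      fin_cases i <;> fin_cases j <;> simp [HH, hof, g, this, h']
    · fin_cases i <;> fin_cases j <;> simp [EF, hof, g, S.ef00, S.ef01, S.ef10, S.ef11]
    · fin_cases i <;> fin_cases j <;>
        simp [HE, hof, g, hw, S.he00, S.he01, S.he10, S.he11, CartanMatrix.G₂]
    · fin_cases i <;> fin_cases j <;>
        simp [HF, hof, g, hw, S.hf00, S.hf01, S.hf10, S.hf11, CartanMatrix.G₂]
    -- The diagonal pairs occur too: there the exponent truncates to 0 and the relation is ⁅Eᵢ, Eᵢ⁆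
    -- = 0.
    · fin_cases i <;> fin_cases j <;>
        simp [adE, hof, g, CartanMatrix.G₂, h1, h3, pow_succ, S.e01, S.e10]
    · fin_cases i <;> fin_cases j <;>
        simp [adF, hof, g, CartanMatrix.G₂, h1, h3, pow_succ, S.f01, S.f10]
  exact ⟨quotientLift _ ψ fun x hx => LieHom.mem_ker.mp (hker hx),
    hof _, hof _, hof _, hof _, hof _, hof _⟩

/-! ### The seven-dimensional representation -/

section Seven

attribute [local instance] LieRing.ofAssociativeRing LieAlgebra.ofAssociativeAlgebra

/-- The short simple root vector of `𝔤₂` on the `7`-dimensional representation. -/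
def sevenE₀ : Matrix (Fin 7) (Fin 7) ℤ :=
  !![0, 1, 0, 0, 0, 0, 0; 0, 0, 0, 0, 0, 0, 0; 0, 0, 0, 2, 0, 0, 0; 0, 0, 0, 0, 1, 0, 0;
    0, 0, 0, 0, 0, 0, 0; 0, 0, 0, 0, 0, 0, 1; 0, 0, 0, 0, 0, 0, 0]

/-- The negative short simple root vector on the `7`-dimensional representation. -/
def sevenF₀ : Matrix (Fin 7) (Fin 7) ℤ :=
  !![0, 0, 0, 0, 0, 0, 0; 1, 0, 0, 0, 0, 0, 0; 0, 0, 0, 0, 0, 0, 0; 0, 0, 1, 0, 0, 0, 0;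
    0, 0, 0, 2, 0, 0, 0; 0, 0, 0, 0, 0, 0, 0; 0, 0, 0, 0, 0, 1, 0]

/-- The long simple root vector on the `7`-dimensional representation. -/
def sevenE₁ : Matrix (Fin 7) (Fin 7) ℤ :=
  !![0, 0, 0, 0, 0, 0, 0; 0, 0, 1, 0, 0, 0, 0; 0, 0, 0, 0, 0, 0, 0; 0, 0, 0, 0, 0, 0, 0;
    0, 0, 0, 0, 0, 1, 0; 0, 0, 0, 0, 0, 0, 0; 0, 0, 0, 0, 0, 0, 0]

/-- The negative long simple root vector on the `7`-dimensional representation. -/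
def sevenF₁ : Matrix (Fin 7) (Fin 7) ℤ :=
  !![0, 0, 0, 0, 0, 0, 0; 0, 0, 0, 0, 0, 0, 0; 0, 1, 0, 0, 0, 0, 0; 0, 0, 0, 0, 0, 0, 0;
    0, 0, 0, 0, 0, 0, 0; 0, 0, 0, 0, 1, 0, 0; 0, 0, 0, 0, 0, 0, 0]

/-- The short simple coroot on the `7`-dimensional representation. -/
def sevenH₀ : Matrix (Fin 7) (Fin 7) ℤ := Matrix.diagonal ![1, -1, 2, 0, -2, 1, -1]

/-- The long simple coroot on the `7`-dimensional representation. -/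
def sevenH₁ : Matrix (Fin 7) (Fin 7) ℤ := Matrix.diagonal ![0, 1, -1, 0, 1, -1, 0]

theorem seven_e01 : ⁅sevenE₀, ⁅sevenE₀, ⁅sevenE₀, ⁅sevenE₀, sevenE₁⁆⁆⁆⁆ = 0 := by
  decide +kernel

theorem seven_e10 : ⁅sevenE₁, ⁅sevenE₁, sevenE₀⁆⁆ = 0 := by decide +kernel

theorem seven_f01 : ⁅sevenF₀, ⁅sevenF₀, ⁅sevenF₀, ⁅sevenF₀, sevenF₁⁆⁆⁆⁆ = 0 := by
  decide +kernel

theorem seven_f10 : ⁅sevenF₁, ⁅sevenF₁, sevenF₀⁆⁆ = 0 := by decide +kernel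

/-- The `7`-dimensional representation of `𝔤₂` satisfies the Serre relations. -/
theorem serreG2_seven :
    let m : Matrix (Fin 7) (Fin 7) ℤ → Matrix (Fin 7) (Fin 7) ℂ :=
      (Int.castRingHom ℂ).mapMatrix
    SerreG2 (m sevenE₀) (m sevenE₁) (m sevenF₀) (m sevenF₁) (m sevenH₀) (m sevenH₁) := by
  intro m
  -- The relations have integer coefficients, so they can be evaluated on integer matrices and
  -- transported to ℂ.
  have hl : ∀ A B, ⁅m A, m B⁆ = m ⁅A, B⁆ := fun A B => by
    simp only [m, Ring.lie_def, map_sub, map_mul]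
  have hs : ∀ (n : ℤ) A, (n : ℂ) • m A = m (n • A) := fun n A => by
    simp only [m, map_zsmul, Int.cast_smul_eq_zsmul]
  have h0 : m 0 = 0 := map_zero _
  have ht : ∀ {A B : Matrix (Fin 7) (Fin 7) ℤ} (n : ℤ), A = n • B → m A = (n : ℂ) • m B :=
    fun n h => by rw [hs, h]
  constructor <;> simp only [hl]
  · rw [← h0]; congr 1; decide +kernel
  · congr 1; decide +kernel
  · congr 1; decide +kernel
  · rw [← h0]; congr 1; decide +kernel
  · rw [← h0]; congr 1; decide +kernel
  · exact_mod_cast ht 2 (by decide +kernel)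
  · exact_mod_cast ht (-3) (by decide +kernel)
  · exact_mod_cast ht (-1) (by decide +kernel)
  · exact_mod_cast ht 2 (by decide +kernel)
  · exact_mod_cast ht (-2) (by decide +kernel)
  · exact_mod_cast ht 3 (by decide +kernel)
  · exact_mod_cast ht 1 (by decide +kernel)
  · exact_mod_cast ht (-2) (by decide +kernel)
  · rw [seven_e01, h0]
  · rw [seven_e10, h0]
  · rw [seven_f01, h0]
  · rw [seven_f10, h0]

/-- The relations alone do not exclude a collapse of the quotient; a representation with nonzero
image does. This one generator suffices, by the ideal argument in `gBasis_ne_zero`. -/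
theorem gE_zero_ne_zero : gE 0 ≠ 0 := by
  intro h
  obtain ⟨φ, h1, -⟩ := serreG2_seven.exists_lift
  rw [h, map_zero] at h1
  have := congrFun (congrFun h1 0) 1
  simp [sevenE₀] at this

end Seven

/-! ### The root basis, dimension and simplicity of 𝔤₂ -/

/-- The roots of `𝔤₂`: positive roots on the left, negative roots on the right. -/
abbrev RootIdx := Fin 6 ⊕ Fin 6

/-- The basis of `𝔤₂` formed by root vectors and by the simple coroots. -/
def gBasis : RootIdx ⊕ Fin 2 → LieAlgebra.g₂ ℂ :=
  Sum.elim (Sum.elim (SerreG2.rootVec (gE 0) (gE 1)) (SerreG2.rootVec (gF 0) (gF 1))) gH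

/-- The degree of a root if the simple roots have degrees `p` and `q`. -/
def rootDeg (p q : ℤ) : RootIdx → ℤ :=
  Sum.elim (fun i => p * SerreG2.coeffShort i + q * SerreG2.coeffLong i)
    (fun i => -(p * SerreG2.coeffShort i + q * SerreG2.coeffLong i))

/-- The degree of an element of the basis if the simple roots have degrees `p` and `q`. -/
def gDeg (p q : ℤ) : RootIdx ⊕ Fin 2 → ℤ := Sum.elim (rootDeg p q) 0

/-- The element of the Cartan subalgebra on which the simple roots take the values `p` and `q`. -/
def gGrade (p q : ℤ) : LieAlgebra.g₂ ℂ :=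
  (2 * p + q : ℂ) • gH 0 + (3 * p + 2 * q : ℂ) • gH 1

/-- The coefficients of `gGrade` come from inverting the Cartan matrix, which has determinant 1; it
therefore acts on the simple root vectors by p and q. -/
theorem gGrade_gBasis (p q : ℤ) (i : RootIdx ⊕ Fin 2) :
    ⁅gGrade p q, gBasis i⁆ = (gDeg p q i : ℂ) • gBasis i := by
  have S := serreG2_g
  rcases i with (i | i) | i
  · have e0 : ⁅gGrade p q, gE 0⁆ = (p : ℂ) • gE 0 := by
      rw [gGrade, add_lie, smul_lie, smul_lie, S.he00, S.he10]; module
    have e1 : ⁅gGrade p q, gE 1⁆ = (q : ℂ) • gE 1 := by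
      rw [gGrade, add_lie, smul_lie, smul_lie, S.he01, S.he11]; module
    refine (SerreG2.lie_rootVec e0 e1 i).trans ?_
    simp [gBasis, gDeg, rootDeg, mul_comm]
  · have e0 : ⁅gGrade p q, gF 0⁆ = (-p : ℂ) • gF 0 := by
      rw [gGrade, add_lie, smul_lie, smul_lie, S.hf00, S.hf10]; module
    have e1 : ⁅gGrade p q, gF 1⁆ = (-q : ℂ) • gF 1 := by
      rw [gGrade, add_lie, smul_lie, smul_lie, S.hf01, S.hf11]; module
    refine (SerreG2.lie_rootVec e0 e1 i).trans ?_
    simp only [gBasis, gDeg, rootDeg, Sum.elim_inl, Sum.elim_inr]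
    congr 1
    push_cast
    ring
  · simp [gGrade, gBasis, gDeg, gH_gH]

theorem lieSpan_gens : LieSubalgebra.lieSpan ℂ (LieAlgebra.g₂ ℂ)
    (Set.range gE ∪ Set.range gF ∪ Set.range gH) = ⊤ := by
  rw [← top_le_iff, ← lieSpan_range_eq_top_of_surjective g₂Mk g₂Mk_surjective]
  apply LieSubalgebra.lieSpan_mono
  rintro _ ⟨(i | i | i), rfl⟩
  · exact Or.inr ⟨i, rfl⟩
  · exact Or.inl (Or.inl ⟨i, rfl⟩)
  · exact Or.inl (Or.inr ⟨i, rfl⟩)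

theorem span_gBasis : Submodule.span ℂ (Set.range gBasis) = ⊤ := by
  have S := serreG2_g
  set T := Submodule.span ℂ (Set.range gBasis) with hT
  have hb : ∀ i, gBasis i ∈ T := fun i => Submodule.subset_span ⟨i, rfl⟩
  have hp : ∀ i, SerreG2.rootVec (gE 0) (gE 1) i ∈ T := fun i => hb (.inl (.inl i))
  have hn : ∀ i, SerreG2.rootVec (gF 0) (gF 1) i ∈ T := fun i => hb (.inl (.inr i))
  have hh : ∀ i, gH i ∈ T := fun i => hb (.inr i)
  have hE : ∀ i, gE i ∈ T := by
    intro i; fin_cases i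
    exacts [hp 0, hp 1]
  have hF : ∀ i, gF i ∈ T := by
    intro i; fin_cases i
    exacts [hn 0, hn 1]
  have hHb : ∀ i j, ⁅gH i, gBasis j⁆ ∈ T := by
    intro i j
    -- The witnesses are the rows of the Cartan matrix, the values of the simple roots at Hᵢ.
    have : ∃ p q : ℤ, gH i = gGrade p q := by
      fin_cases i
      · exact ⟨2, -3, by simp [gGrade]; norm_num⟩
      · exact ⟨-1, 2, by simp [gGrade]; norm_num⟩
    obtain ⟨p, q, h⟩ := this
    rw [h, gGrade_gBasis]
    exact T.smul_mem _ (hb j)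
  refine eq_top_of_lie_stable lieSpan_gens T ?_ ?_
  · rintro _ ((⟨i, rfl⟩ | ⟨i, rfl⟩) | ⟨i, rfl⟩)
    exacts [hE i, hF i, hh i]
  · rintro g hg s hs
    have key : ∀ i, ⁅g, gBasis i⁆ ∈ T := by
      have k1 := S.lie_mem_span hp (hh 0) (hh 1)
      have k2 := S.symm.lie_mem_span hn (neg_mem (hh 0)) (neg_mem (hh 1))
      have gHlie : ∀ (x : LieAlgebra.g₂ ℂ), (∃ j, x = gBasis j) → ∀ i, ⁅x, gH i⁆ ∈ T := by
        rintro _ ⟨j, rfl⟩ i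
        rw [← lie_skew]; exact neg_mem (hHb i j)
      rcases hg with (⟨j, rfl⟩ | ⟨j, rfl⟩) | ⟨j, rfl⟩
      · rintro ((i | i) | i)
        · fin_cases j
          exacts [(k1 i).1, (k1 i).2.1]
        · fin_cases j
          exacts [(k2 i).2.2.1, (k2 i).2.2.2]
        · refine gHlie _ ?_ i
          fin_cases j
          exacts [⟨.inl (.inl 0), rfl⟩, ⟨.inl (.inl 1), rfl⟩]
      · rintro ((i | i) | i)
        · fin_cases j
          exacts [(k1 i).2.2.1, (k1 i).2.2.2]
        · fin_cases j
          exacts [(k2 i).1, (k2 i).2.1]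
        · refine gHlie _ ?_ i
          fin_cases j
          exacts [⟨.inl (.inr 0), rfl⟩, ⟨.inl (.inr 1), rfl⟩]
      · exact hHb j
    induction hs using Submodule.span_induction with
    | mem x h => obtain ⟨i, rfl⟩ := h; exact key i
    | zero => simp
    | add x y _ _ h1 h2 => rw [lie_add]; exact add_mem h1 h2
    | smul a x _ h => rw [lie_smul]; exact T.smul_mem _ h

theorem gH_mem_of_gBasis_mem {I : LieIdeal ℂ (LieAlgebra.g₂ ℂ)} {i : RootIdx ⊕ Fin 2}
    (hi : gBasis i ∈ I) : gH 0 ∈ I ∨ gH 1 ∈ I := by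
  rcases i with (i | i) | i
  · exact serreG2_g.h_mem_of_rootVec_mem hi
  · simpa using serreG2_g.symm.h_mem_of_rootVec_mem hi
  · fin_cases i
    exacts [Or.inl hi, Or.inr hi]

/-- A vanishing basis vector would lie in the zero ideal; descending to a coroot and then to `gE 0`
would make `gE 0` vanish. -/
theorem gBasis_ne_zero (i : RootIdx ⊕ Fin 2) : gBasis i ≠ 0 := by
  intro h
  have h1 : gBasis i ∈ (⊥ : LieIdeal ℂ (LieAlgebra.g₂ ℂ)) := by rw [h]; exact zero_mem _
  exact gE_zero_ne_zero (by simpa using (serreG2_g.e_mem_of_h_mem (gH_mem_of_gBasis_mem h1)).1)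

theorem eq_top_of_gBasis_mem {I : LieIdeal ℂ (LieAlgebra.g₂ ℂ)} {i : RootIdx ⊕ Fin 2}
    (hi : gBasis i ∈ I) : I = ⊤ := by
  have S := serreG2_g
  have h := gH_mem_of_gBasis_mem hi
  obtain ⟨e0, e1⟩ := S.e_mem_of_h_mem h
  obtain ⟨f0, f1⟩ := S.symm.e_mem_of_h_mem (I := I) (by simpa using h)
  have h0 : gH 0 ∈ I := by rw [← S.ef00]; exact lie_mem_left ℂ _ I _ _ e0
  have h1 : gH 1 ∈ I := by rw [← S.ef11]; exact lie_mem_left ℂ _ I _ _ e1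
  rw [← LieSubmodule.toSubmodule_eq_top]
  refine eq_top_of_lie_stable lieSpan_gens _ ?_ fun g _ s hs => lie_mem_right ℂ _ I _ _ hs
  rintro _ ((⟨i, rfl⟩ | ⟨i, rfl⟩) | ⟨i, rfl⟩) <;> fin_cases i <;> assumption

theorem gH_combination_eq_zero {α β : ℂ}
    (h0 : ⁅α • gH 0 + β • gH 1, gE 0⁆ = 0) (h1 : ⁅α • gH 0 + β • gH 1, gE 1⁆ = 0) :
    α = 0 ∧ β = 0 := by
  have S := serreG2_g
  have n0 : gE 0 ≠ 0 := gBasis_ne_zero (.inl (.inl 0))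
  have n1 : gE 1 ≠ 0 := gBasis_ne_zero (.inl (.inl 1))
  rw [add_lie, smul_lie, smul_lie, S.he00, S.he10, smul_smul, smul_smul, ← add_smul] at h0
  rw [add_lie, smul_lie, smul_lie, S.he01, S.he11, smul_smul, smul_smul, ← add_smul] at h1
  have a := (smul_eq_zero.mp h0).resolve_right n0
  have b := (smul_eq_zero.mp h1).resolve_right n1
  constructor
  · linear_combination 2 * a + b
  · linear_combination 3 * a + 2 * b

/-- With weights 1 and 5 the positive roots have degrees 1, 5, 6, 7, 8, 13, so `gGrade 1 5` is a
regular element separating all roots from each other and from 0. -/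
theorem rootDeg_injective : Function.Injective (rootDeg 1 5) := by decide

theorem rootDeg_ne_zero : ∀ i, rootDeg 1 5 i ≠ 0 := by decide

theorem gBasis_mem_eigenspace (p q : ℤ) (i : RootIdx ⊕ Fin 2) :
    gBasis i ∈ (LieAlgebra.ad ℂ (LieAlgebra.g₂ ℂ) (gGrade p q)).eigenspace (gDeg p q i : ℂ) := by
  rw [Module.End.mem_eigenspace_iff]
  exact gGrade_gBasis p q i

/-- Root vectors are eigenvectors of a regular element for distinct nonzero eigenvalues; the coroots
lie in its 0-eigenspace and are independent because the Cartan matrix is invertible. -/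
theorem linearIndependent_gBasis : LinearIndependent ℂ gBasis := by
  have hr : ∀ i : RootIdx, Module.End.HasEigenvector
      (LieAlgebra.ad ℂ (LieAlgebra.g₂ ℂ) (gGrade 1 5)) (rootDeg 1 5 i : ℂ) (gBasis (.inl i)) :=
    fun i => ⟨gBasis_mem_eigenspace 1 5 (.inl i), gBasis_ne_zero _⟩
  rw [← Sum.elim_comp_inl_inr gBasis]
  refine LinearIndependent.sum_type (v := fun i => gBasis (.inl i)) (v' := gH) ?_ ?_ ?_
  · refine Module.End.eigenvectors_linearIndependent' _ (fun i => (rootDeg 1 5 i : ℂ)) ?_ _ hr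
    exact Int.cast_injective.comp rootDeg_injective
  · rw [Fintype.linearIndependent_iff]
    intro g hg
    rw [Fin.sum_univ_two] at hg
    have := gH_combination_eq_zero (α := g 0) (β := g 1) (by rw [hg, zero_lie])
      (by rw [hg, zero_lie])
    intro i
    fin_cases i
    exacts [this.1, this.2]
  · have := (Module.End.eigenspaces_iSupIndep
      (LieAlgebra.ad ℂ (LieAlgebra.g₂ ℂ) (gGrade 1 5))) 0
    refine (this.mono ?_ ?_).symm
    · rw [Submodule.span_le]
      rintro _ ⟨i, rfl⟩
      simpa [gDeg, gBasis] using gBasis_mem_eigenspace 1 5 (.inr i)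
    · rw [Submodule.span_le]
      rintro _ ⟨i, rfl⟩
      refine Submodule.mem_iSup_of_mem _ (Submodule.mem_iSup_of_mem ?_ (hr i).1)
      exact_mod_cast rootDeg_ne_zero i

/-- The vectors of `gBasis` as a basis of `𝔤₂`. -/
def g₂Basis : Module.Basis (RootIdx ⊕ Fin 2) ℂ (LieAlgebra.g₂ ℂ) :=
  Module.Basis.mk linearIndependent_gBasis span_gBasis.ge

instance finiteDimensional_g₂ : FiniteDimensional ℂ (LieAlgebra.g₂ ℂ) :=
  Module.Finite.of_basis g₂Basis

theorem finrank_g₂ : Module.finrank ℂ (LieAlgebra.g₂ ℂ) = 14 := by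
  rw [Module.finrank_eq_card_basis g₂Basis]
  rfl

/-- The span of the elements of the basis of a given degree. -/
def degSpan (p q : ℤ) (μ : ℂ) : Submodule ℂ (LieAlgebra.g₂ ℂ) :=
  Submodule.span ℂ (gBasis '' {i | (gDeg p q i : ℂ) = μ})

theorem iSup_degSpan (p q : ℤ) : ⨆ μ, degSpan p q μ = ⊤ := by
  rw [← top_le_iff, ← span_gBasis, Submodule.span_le]
  rintro _ ⟨i, rfl⟩
  exact Submodule.mem_iSup_of_mem (gDeg p q i : ℂ) (Submodule.subset_span ⟨i, rfl, rfl⟩)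

/-- Each span lies in the eigenspace, the spans exhaust 𝔤₂, and the eigenspaces are independent, so
no inclusion can be strict. -/
theorem degSpan_eq_eigenspace (p q : ℤ) : degSpan p q =
    (LieAlgebra.ad ℂ (LieAlgebra.g₂ ℂ) (gGrade p q)).eigenspace := by
  rw [← iSupIndep.le_iff_eq_of_iSup_eq_top (Module.End.eigenspaces_iSupIndep _)
    (iSup_degSpan p q)]
  intro μ
  refine Submodule.span_le.mpr ?_
  rintro _ ⟨i, rfl, rfl⟩
  exact gBasis_mem_eigenspace p q i

/-- An eigenvector of the regular element is a multiple of a root vector or a Cartan element; in the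
latter case one of its brackets with the simple root vectors is a nonzero multiple of that root
vector. -/
theorem exists_gBasis_mem {I : LieIdeal ℂ (LieAlgebra.g₂ ℂ)} {x : LieAlgebra.g₂ ℂ} {μ : ℂ}
    (hx : x ∈ I) (hμ : x ∈ degSpan 1 5 μ) (h0 : x ≠ 0) : ∃ i, gBasis i ∈ I := by
  by_cases hi : ∃ i, (rootDeg 1 5 i : ℂ) = μ
  · obtain ⟨i, rfl⟩ := hi
    have : {j | (gDeg 1 5 j : ℂ) = rootDeg 1 5 i} ⊆ {.inl i} := by
      rintro (j | j) hj
      · simpa [gDeg, rootDeg_injective.eq_iff] using hj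
      · have : (0 : ℤ) = rootDeg 1 5 i := by simpa [gDeg] using hj
        exact absurd this.symm (rootDeg_ne_zero i)
    have hμ' := Submodule.span_mono (Set.image_mono this) hμ
    rw [Set.image_singleton, Submodule.mem_span_singleton] at hμ'
    obtain ⟨c, rfl⟩ := hμ'
    have hc : c ≠ 0 := by rintro rfl; simp at h0
    exact ⟨_, (I.toSubmodule.smul_mem_iff hc).mp hx⟩
  · have : gBasis '' {j | (gDeg 1 5 j : ℂ) = μ} ⊆ {gH 0, gH 1} := by
      rintro _ ⟨j | j, hj, rfl⟩
      · exact absurd ⟨j, hj⟩ hi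
      · fin_cases j
        exacts [Or.inl rfl, Or.inr rfl]
    have hμ' := Submodule.span_mono this hμ
    rw [Submodule.mem_span_pair] at hμ'
    obtain ⟨α, β, rfl⟩ := hμ'
    have S := serreG2_g
    have k0 := lie_mem_left ℂ _ I _ (gE 0) hx
    have k1 := lie_mem_left ℂ _ I _ (gE 1) hx
    by_cases c0 : ⁅α • gH 0 + β • gH 1, gE 0⁆ = 0
    · by_cases c1 : ⁅α • gH 0 + β • gH 1, gE 1⁆ = 0
      · obtain ⟨rfl, rfl⟩ := gH_combination_eq_zero c0 c1
        simp at h0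
      · rw [add_lie, smul_lie, smul_lie, S.he01, S.he11, smul_smul, smul_smul, ← add_smul] at c1 k1
        exact ⟨.inl (.inl 1), (I.toSubmodule.smul_mem_iff (left_ne_zero_of_smul c1)).mp k1⟩
    · rw [add_lie, smul_lie, smul_lie, S.he00, S.he10, smul_smul, smul_smul, ← add_smul] at c0 k0
      exact ⟨.inl (.inl 0), (I.toSubmodule.smul_mem_iff (left_ne_zero_of_smul c0)).mp k0⟩

/-- An ideal is stable under the diagonalizable operator ad `gGrade 1 5`, so it is the sum of its
intersections with the eigenspaces. -/
theorem g₂_eq_bot_or_eq_top (I : LieIdeal ℂ (LieAlgebra.g₂ ℂ)) : I = ⊥ ∨ I = ⊤ := by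
  by_cases h : ∃ i, gBasis i ∈ I
  · obtain ⟨i, hi⟩ := h
    exact Or.inr (eq_top_of_gBasis_mem hi)
  left
  rw [← LieSubmodule.toSubmodule_eq_bot,
    Submodule.eq_iSup_inf_genEigenspace (f := LieAlgebra.ad ℂ _ (gGrade 1 5)) 1
      (fun x hx => lie_mem_right ℂ _ I (gGrade 1 5) x hx)
      (by have := iSup_degSpan 1 5; rwa [degSpan_eq_eigenspace] at this)]
  rw [iSup_eq_bot]
  intro μ
  rw [Submodule.eq_bot_iff]
  rintro x ⟨hx, hμ⟩
  by_contra h0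
  refine h (exists_gBasis_mem hx (μ := μ) ?_ h0)
  rw [degSpan_eq_eigenspace]
  exact hμ

instance isSimple_g₂ : LieAlgebra.IsSimple ℂ (LieAlgebra.g₂ ℂ) where
  eq_bot_or_eq_top := g₂_eq_bot_or_eq_top
  non_abelian := fun h => gBasis_ne_zero (.inr 0) (by
    rw [gBasis, Sum.elim_inr, ← serreG2_g.ef00]
    exact h.trivial _ _)

/-! ### The Cartan grading -/

theorem gDeg_eq (p q : ℤ) (k : RootIdx ⊕ Fin 2) : gDeg p q k = p * gDeg 1 0 k + q * gDeg 0 1 k := by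
  rcases k with (k | k) | k <;> simp [gDeg, rootDeg]
  ring

theorem gH_eq_gGrade (i : Fin 2) :
    gH i = gGrade (CartanMatrix.G₂ i 0) (CartanMatrix.G₂ i 1) := by
  fin_cases i <;> simp [gGrade, CartanMatrix.G₂] <;> norm_num

theorem gBasis_mem_serreRootSpace (k : RootIdx ⊕ Fin 2) :
    gBasis k ∈ serreRootSpace ℂ CartanMatrix.G₂ ![gDeg 1 0 k, gDeg 0 1 k] := by
  rw [serreRootSpace, Submodule.mem_iInf]
  intro i
  rw [serreH_eq_gH, gH_eq_gGrade]
  convert gBasis_mem_eigenspace _ _ k using 2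
  rw [gDeg_eq (CartanMatrix.G₂ i 0), Fin.sum_univ_two]
  simp [mul_comm]

/-- The element `gGrade 1 0` = 2H₀ + 3H₁ acts on the root space of `a` by the coefficient `a 0`. -/
theorem heightGrading_le (i : ℤ) : heightGrading ℂ CartanMatrix.G₂ {0} i ≤
    (LieAlgebra.ad ℂ (LieAlgebra.g₂ ℂ) (gGrade 1 0)).eigenspace (i : ℂ) := by
  rw [heightGrading, iSup_le_iff]
  rintro ⟨a, ha⟩ x hx
  rw [Finset.sum_singleton] at ha
  subst ha
  rw [serreRootSpace, Submodule.mem_iInf] at hx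
  have h0 := Module.End.mem_eigenspace_iff.mp (hx 0)
  have h1 := Module.End.mem_eigenspace_iff.mp (hx 1)
  have c00 : CartanMatrix.G₂ 0 0 = 2 := rfl
  have c01 : CartanMatrix.G₂ 0 1 = -3 := rfl
  have c10 : CartanMatrix.G₂ 1 0 = -1 := rfl
  have c11 : CartanMatrix.G₂ 1 1 = 2 := rfl
  rw [LieAlgebra.ad_apply, serreH_eq_gH, Fin.sum_univ_two] at h0 h1
  rw [Module.End.mem_eigenspace_iff, LieAlgebra.ad_apply, gGrade, add_lie, smul_lie, smul_lie, h0,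
    h1, c00, c01, c10, c11]
  push_cast
  module

theorem cartanGrading_eq (i : ℤ) : cartanGrading i = degSpan 1 0 i := by
  apply le_antisymm
  · rw [degSpan_eq_eigenspace]
    exact heightGrading_le i
  · rw [degSpan, Submodule.span_le]
    rintro _ ⟨k, hk, rfl⟩
    have hk' : gDeg 1 0 k = i := Int.cast_injective (α := ℂ) hk
    exact Submodule.mem_iSup_of_mem
      (⟨![gDeg 1 0 k, gDeg 0 1 k], by simpa using hk'⟩ : {a : Fin 2 → ℤ // ∑ j ∈ {0}, a j = i})
      (gBasis_mem_serreRootSpace k)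

theorem cartanGrading_eq_eigenspace (i : ℤ) : cartanGrading i =
    (LieAlgebra.ad ℂ (LieAlgebra.g₂ ℂ) (gGrade 1 0)).eigenspace (i : ℂ) := by
  rw [cartanGrading_eq, degSpan_eq_eigenspace]

theorem gBasis_mem_cartanGrading (k : RootIdx ⊕ Fin 2) : gBasis k ∈ cartanGrading (gDeg 1 0 k) := by
  rw [cartanGrading_eq]
  exact Submodule.subset_span ⟨k, rfl, rfl⟩

theorem cartanGrading_le {i : ℤ} {T : Submodule ℂ (LieAlgebra.g₂ ℂ)}
    (h : ∀ k, gDeg 1 0 k = i → gBasis k ∈ T) : cartanGrading i ≤ T := by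
  rw [cartanGrading_eq, degSpan, Submodule.span_le]
  rintro _ ⟨k, hk, rfl⟩
  exact h k (Int.cast_injective (α := ℂ) hk)

theorem iSup_cartanGrading : ⨆ i, cartanGrading i = ⊤ := by
  rw [← top_le_iff, ← span_gBasis, Submodule.span_le]
  rintro _ ⟨k, rfl⟩
  exact Submodule.mem_iSup_of_mem _ (gBasis_mem_cartanGrading k)

/-- The negative short simple root vector, of degree `-1` for the Cartan grading. -/
def negX : LieAlgebra.g₂ ℂ := gF 0

/-- The other root vector of degree `-1` for the Cartan grading. -/
def negY : LieAlgebra.g₂ ℂ := ⁅gF 0, gF 1⁆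

/-- The vector ⁅f₁, c⁆ is built with `gF 1`, of degree 0; this rewrites it through elements of
degree -1 alone, up to a sign. -/
theorem gBasis_neg_five : gBasis (.inl (.inr 5)) = -⁅negY, ⁅negX, negY⁆⁆ :=
  eq_neg_of_add_eq_zero_left (by
    rw [negY, negX, serreG2_g.symm.a_b]
    exact add_neg_cancel _)

theorem negX_mem : negX ∈ cartanGrading (-1) := gBasis_mem_cartanGrading (.inl (.inr 0))

theorem negY_mem : negY ∈ cartanGrading (-1) := gBasis_mem_cartanGrading (.inl (.inr 2))

/-- A property of the negative root vectors of the Cartan grading can be checked on brackets of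
`negX` and `negY`. -/
theorem gBasis_neg_induction {p : ℤ → LieAlgebra.g₂ ℂ → Prop} (hX : p (-1) negX) (hY : p (-1) negY)
    (hu : p (-2) ⁅negX, negY⁆) (hP : p (-3) ⁅negX, ⁅negX, negY⁆⁆)
    (hQ : p (-3) (-⁅negY, ⁅negX, negY⁆⁆)) {k : RootIdx ⊕ Fin 2} (hk : gDeg 1 0 k < 0) :
    p (gDeg 1 0 k) (gBasis k) := by
  rcases k with (k | k) | k
  · have : ∀ k : Fin 6, ¬ gDeg 1 0 (.inl (.inl k)) < 0 := by decide
    exact absurd hk (this k)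
  · fin_cases k
    · exact hX
    · exact absurd hk (by decide)
    · exact hY
    · exact hu
    · exact hP
    · have h := gBasis_neg_five
      change p (-3) (gBasis (.inl (.inr 5)))
      rw [h]; exact hQ
  · have : ∀ k : Fin 2, ¬ gDeg 1 0 (.inr k) < 0 := by decide
    exact absurd hk (this k)

theorem gDeg_abs_le (k : RootIdx ⊕ Fin 2) : |gDeg 1 0 k| ≤ 3 := by
  revert k; decide

theorem isKGrading_cartanGrading : IsKGrading 3 cartanGrading where
  isInternal := by
    rw [DirectSum.isInternal_submodule_iff_iSupIndep_and_iSup_eq_top]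
    refine ⟨?_, iSup_cartanGrading⟩
    have := (Module.End.eigenspaces_iSupIndep
      (LieAlgebra.ad ℂ (LieAlgebra.g₂ ℂ) (gGrade 1 0))).comp (Int.cast_injective (α := ℂ))
    convert this using 1
    ext1 i
    exact cartanGrading_eq_eigenspace i
  gradedBracket := by
    constructor
    intro i j x y hx hy
    rw [cartanGrading_eq_eigenspace, Module.End.mem_eigenspace_iff, LieAlgebra.ad_apply] at *
    rw [lie_eq_smul_of_lie_eq_smul hx hy, Int.cast_add]
  eq_bot := by
    intro i hi
    rw [eq_bot_iff]
    refine cartanGrading_le fun k hk => ?_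
    subst hk
    exact absurd (gDeg_abs_le k) (not_le.mpr hi)
  ne_bot := by
    intro h
    have := gBasis_mem_cartanGrading (.inl (.inr 4))
    change _ ∈ cartanGrading (-((3 : ℕ) : ℤ)) at this
    rw [h] at this
    exact gBasis_ne_zero _ this
  generated := by
    intro i hi
    refine cartanGrading_le fun k hk => ?_
    subst hk
    set K := LieSubalgebra.lieSpan ℂ (LieAlgebra.g₂ ℂ) (cartanGrading (-1) : Set (LieAlgebra.g₂ ℂ))
    have hX : negX ∈ K := LieSubalgebra.subset_lieSpan negX_mem
    have hY : negY ∈ K := LieSubalgebra.subset_lieSpan negY_mem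
    have hu := K.lie_mem hX hY
    exact gBasis_neg_induction (p := fun _ x => x ∈ K) hX hY hu (K.lie_mem hX hu)
      (neg_mem (K.lie_mem hY hu)) hi

/-! ### Nilpotency of the negative part -/

section Graded

variable {R L : Type*} [CommRing R] [LieRing L] [LieAlgebra R L] {k : ℕ} {𝔫 : ℤ → Submodule R L}

/-- Term `n` of the series is spanned by brackets of n + 1 elements of degree at most -1, whence the
strict bound. -/
theorem lowerCentralSeries_negativePart_le (h : IsKGrading k 𝔫) (n : ℕ) :
    ∀ x ∈ LieModule.lowerCentralSeries R (negativePart h) (negativePart h) n,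
      (x : L) ∈ ⨆ i : {i : ℤ // i < -n}, 𝔫 i := by
  induction n with
  | zero =>
    intro x _
    have h0 : (x : L) ∈ ⨆ i : {i : ℤ // i < 0}, 𝔫 i := x.2
    have h1 : ⨆ i : {i : ℤ // i < 0}, 𝔫 i ≤ ⨆ i : {i : ℤ // i < -((0 : ℕ) : ℤ)}, 𝔫 i :=
      iSup_le fun i => le_iSup (fun j : {i : ℤ // i < -((0 : ℕ) : ℤ)} => 𝔫 j)
        ⟨i, by simpa using i.2⟩
    exact h1 h0
  | succ n ih =>
    intro x hx
    rw [LieModule.lowerCentralSeries_succ, ← LieSubmodule.mem_toSubmodule,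
      LieSubmodule.lieIdeal_oper_eq_linear_span'] at hx
    induction hx using Submodule.span_induction with
    | mem x hx =>
      obtain ⟨y, -, z, hz, rfl⟩ := hx
      have hz' := ih z hz
      have hy : (y : L) ∈ ⨆ i : {i : ℤ // i < 0}, 𝔫 i := y.2
      rw [LieSubalgebra.coe_bracket]
      generalize (y : L) = y' at hy
      generalize (z : L) = z' at hz'
      induction hy using Submodule.iSup_induction' with
      | mem i x hx =>
        induction hz' using Submodule.iSup_induction' with
        | mem j y hy =>
          refine Submodule.mem_iSup_of_mem
            (⟨i + j, ?_⟩ : {i : ℤ // i < -((n + 1 : ℕ) : ℤ)}) (h.gradedBracket.bracket_mem hx hy)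
          have := i.2
          have := j.2
          push_cast
          lia
        | zero => simp
        | add y z _ _ hy hz => rw [lie_add]; exact add_mem hy hz
      | zero => simp
      | add x z _ _ hx hz => rw [add_lie]; exact add_mem hx hz
    | zero => simp
    | add x y _ _ h1 h2 => exact add_mem h1 h2
    | smul a x _ h => exact Submodule.smul_mem _ _ h

theorem lowerCentralSeries_negativePart (h : IsKGrading k 𝔫) :
    LieModule.lowerCentralSeries R (negativePart h) (negativePart h) k = ⊥ := by
  rw [LieSubmodule.eq_bot_iff]
  intro x hx
  have h1 := lowerCentralSeries_negativePart_le h k x hx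
  have h2 : ⨆ i : {i : ℤ // i < -(k : ℤ)}, 𝔫 i = ⊥ := by
    rw [iSup_eq_bot]
    rintro ⟨i, hi⟩
    exact h.eq_bot i (by rw [abs_of_neg (by lia)]; lia)
  rw [h2, Submodule.mem_bot] at h1
  exact Subtype.ext h1

theorem mem_negativePart (h : IsKGrading k 𝔫) {i : ℤ} (hi : i < 0) {x : L} (hx : x ∈ 𝔫 i) :
    x ∈ negativePart h :=
  Submodule.mem_iSup_of_mem (⟨i, hi⟩ : {i : ℤ // i < 0}) hx

theorem mem_negativeGrading (h : IsKGrading k 𝔫) {i : ℤ} (hi : i < 0) {x : negativePart h} :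
    x ∈ negativeGrading h i ↔ (x : L) ∈ 𝔫 i := by
  rw [negativeGrading, if_pos hi]
  rfl

end Graded

/-! ### Free nilpotent Lie algebras -/

section FreeNilpotent

variable {R M : Type*} [CommRing R] [LieRing M] [LieAlgebra R M] {r k : ℕ}

/-- The universal property of the free `k`-step nilpotent Lie algebra. -/
theorem exists_freeNilpotent_lift (hM : LieModule.lowerCentralSeries R M M k = ⊥) (g : Fin r → M) :
    ∃ φ : FreeNilpotent R r k →ₗ⁅R⁆ M, ∀ j, φ (freeNilpotentGen R r k j) = g j := by
  let ψ : FreeLieAlgebra R (Fin r) →ₗ⁅R⁆ M := FreeLieAlgebra.lift R g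
  refine ⟨quotientLift _ ψ fun x hx => ?_, fun j => FreeLieAlgebra.lift_of_apply g j⟩
  have h1 : ψ x ∈ LieModule.lowerCentralSeries R M M k := by
    have := LieIdeal.map_lowerCentralSeries_le (f := ψ) k
    exact this (LieIdeal.mem_map hx)
  rw [hM] at h1
  exact h1

theorem lieSpan_freeNilpotentGen :
    LieSubalgebra.lieSpan R (FreeNilpotent R r k) (Set.range (freeNilpotentGen R r k)) = ⊤ :=
  lieSpan_range_eq_top_of_surjective (quotientMk _) (quotientMk_surjective _)

theorem freeNilpotent_lie_four (a b c d : FreeNilpotent R r 3) : ⁅a, ⁅b, ⁅c, d⁆⁆⁆ = 0 := by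
  obtain ⟨a, rfl⟩ := quotientMk_surjective _ a
  obtain ⟨b, rfl⟩ := quotientMk_surjective _ b
  obtain ⟨c, rfl⟩ := quotientMk_surjective _ c
  obtain ⟨d, rfl⟩ := quotientMk_surjective _ d
  rw [← LieHom.map_lie, ← LieHom.map_lie, ← LieHom.map_lie, quotientMk_eq_zero]
  simp only [LieModule.lowerCentralSeries_succ, LieModule.lowerCentralSeries_zero]
  exact LieSubmodule.lie_mem_lie trivial (LieSubmodule.lie_mem_lie trivial
    (LieSubmodule.lie_mem_lie trivial trivial))

theorem freeNilpotentDegree_two_mem (i j : Fin r) :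
    ⁅freeNilpotentGen R r k i, freeNilpotentGen R r k j⁆ ∈ freeNilpotentDegree R r k 2 :=
  Submodule.subset_span ⟨i, _, Submodule.subset_span ⟨j, rfl⟩, rfl⟩

theorem freeNilpotentDegree_three_mem (i j l : Fin r) :
    ⁅freeNilpotentGen R r k i, ⁅freeNilpotentGen R r k j, freeNilpotentGen R r k l⁆⁆ ∈
      freeNilpotentDegree R r k 3 :=
  Submodule.subset_span ⟨i, _, freeNilpotentDegree_two_mem j l, rfl⟩

/-- The basic brackets of length at most `3` in two elements. -/
def basicBrackets (x y : M) : Fin 5 → M :=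
  ![x, y, ⁅x, y⁆, ⁅x, ⁅x, y⁆⁆, ⁅y, ⁅x, y⁆⁆]

theorem span_basicBrackets : Submodule.span R (Set.range (basicBrackets
    (freeNilpotentGen R 2 3 0) (freeNilpotentGen R 2 3 1))) = ⊤ := by
  set x := freeNilpotentGen R 2 3 0 with hx
  set y := freeNilpotentGen R 2 3 1 with hy
  set T := Submodule.span R (Set.range (basicBrackets x y))
  have hT : ∀ i, basicBrackets x y i ∈ T := fun i => Submodule.subset_span ⟨i, rfl⟩
  have t0 : x ∈ T := hT 0
  have t1 : y ∈ T := hT 1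
  have t2 : ⁅x, y⁆ ∈ T := hT 2
  have t3 : ⁅x, ⁅x, y⁆⁆ ∈ T := hT 3
  have t4 : ⁅y, ⁅x, y⁆⁆ ∈ T := hT 4
  have t2' : ⁅y, x⁆ ∈ T := by rw [← lie_skew]; exact neg_mem t2
  have hgen : ∀ i, freeNilpotentGen R 2 3 i = x ∨ freeNilpotentGen R 2 3 i = y := by
    intro i; fin_cases i
    exacts [Or.inl rfl, Or.inr rfl]
  refine eq_top_of_lie_stable lieSpan_freeNilpotentGen T ?_ ?_
  · rintro _ ⟨i, rfl⟩
    rcases hgen i with h | h <;> rw [h] <;> assumption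
  · rintro _ ⟨i, rfl⟩ s hs
    induction hs using Submodule.span_induction with
    | mem z hz =>
      obtain ⟨j, rfl⟩ := hz
      rcases hgen i with h | h <;> rw [h] <;> fin_cases j <;>
        simp [basicBrackets, t2, t2', t3, t4, freeNilpotent_lie_four]
    | zero => simp
    | add _ _ _ _ h1 h2 => rw [lie_add]; exact add_mem h1 h2
    | smul a _ _ h => rw [lie_smul]; exact T.smul_mem _ h

theorem map_freeNilpotentDegree_le {L : Type*} [LieRing L] [LieAlgebra R L] {𝔫 : ℤ → Submodule R L}
    (h : IsKGrading k 𝔫) (ψ : FreeNilpotent R r k →ₗ⁅R⁆ negativePart h)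
    (hψ : ∀ j, (ψ (freeNilpotentGen R r k j) : L) ∈ 𝔫 (-1)) (n : ℕ) :
    ∀ z ∈ freeNilpotentDegree R r k (n + 1), (ψ z : L) ∈ 𝔫 (-((n + 1 : ℕ) : ℤ)) := by
  induction n with
  | zero =>
    intro z hz
    rw [zero_add, freeNilpotentDegree] at hz
    induction hz using Submodule.span_induction with
    | mem z hz => obtain ⟨j, rfl⟩ := hz; exact hψ j
    | zero => simp
    | add x y _ _ h1 h2 => rw [map_add]; exact add_mem h1 h2
    | smul a x _ h => rw [map_smul]; exact Submodule.smul_mem _ _ h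
  | succ n ih =>
    intro z hz
    rw [freeNilpotentDegree] at hz
    induction hz using Submodule.span_induction with
    | mem z hz =>
      obtain ⟨j, y, hy, rfl⟩ := hz
      have := h.gradedBracket.bracket_mem (hψ j) (ih y hy)
      rw [LieHom.map_lie, LieSubalgebra.coe_bracket]
      convert this using 2
      push_cast
      ring
    | zero => simp
    | add x y _ _ h1 h2 => rw [map_add]; exact add_mem h1 h2
    | smul a x _ h => rw [map_smul]; exact Submodule.smul_mem _ _ h

end FreeNilpotent

/-! ### The negative part of the Cartan grading is free -/

/-- `negX` as an element of the negative part of the Cartan grading. -/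
def subX : negativePart isKGrading_cartanGrading :=
  ⟨negX, mem_negativePart _ (by norm_num) negX_mem⟩

/-- `negY` as an element of the negative part of the Cartan grading. -/
def subY : negativePart isKGrading_cartanGrading :=
  ⟨negY, mem_negativePart _ (by norm_num) negY_mem⟩

/-- Up to a sign in the last place these are the negative root vectors other than f₁, which has
degree 0. -/
theorem linearIndependent_basicBrackets_neg : LinearIndependent ℂ (basicBrackets subX subY) := by
  have h1 := linearIndependent_gBasis.comp
    (fun i : Fin 5 => (.inl (.inr (![0, 2, 3, 4, 5] i)) : RootIdx ⊕ Fin 2)) (by decide)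
  have h2 := h1.units_smul ![1, 1, 1, 1, -1]
  refine LinearIndependent.of_comp
    ((negativePart isKGrading_cartanGrading).toSubmodule.subtype) ?_
  convert h2 using 1
  ext1 i
  fin_cases i
  · exact (one_smul ℂˣ _).symm
  · exact (one_smul ℂˣ _).symm
  · exact (one_smul ℂˣ _).symm
  · exact (one_smul ℂˣ _).symm
  · change ⁅negY, ⁅negX, negY⁆⁆ = (-1 : ℂˣ) • gBasis (.inl (.inr 5))
    rw [gBasis_neg_five, Units.neg_smul, one_smul, neg_neg]

theorem exists_lift_negativePart {r : ℕ} (g : Fin r → negativePart isKGrading_cartanGrading) :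
    ∃ φ : FreeNilpotent ℂ r 3 →ₗ⁅ℂ⁆ negativePart isKGrading_cartanGrading,
      ∀ j, φ (freeNilpotentGen ℂ r 3 j) = g j :=
  exists_freeNilpotent_lift (lowerCentralSeries_negativePart _) g

theorem map_basicBrackets {R L M : Type*} [CommRing R] [LieRing L] [LieAlgebra R L] [LieRing M]
    [LieAlgebra R M] (φ : L →ₗ⁅R⁆ M) (x y : L) (i : Fin 5) :
    φ (basicBrackets x y i) = basicBrackets (φ x) (φ y) i := by
  fin_cases i <;> simp [basicBrackets]

/-- The lower bound on the free algebra comes from a model: its basic brackets map to independent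
elements of 𝔤₂. -/
theorem linearIndependent_basicBrackets_free : LinearIndependent ℂ
    (basicBrackets (freeNilpotentGen ℂ 2 3 0) (freeNilpotentGen ℂ 2 3 1)) := by
  obtain ⟨φ, hφ⟩ := exists_lift_negativePart (r := 2) ![subX, subY]
  refine LinearIndependent.of_comp
    (φ : FreeNilpotent ℂ 2 3 →ₗ[ℂ] negativePart isKGrading_cartanGrading) ?_
  have h : (φ : FreeNilpotent ℂ 2 3 →ₗ[ℂ] negativePart isKGrading_cartanGrading) ∘
      basicBrackets (freeNilpotentGen ℂ 2 3 0) (freeNilpotentGen ℂ 2 3 1) =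
      basicBrackets subX subY := by
    ext1 i
    refine (map_basicBrackets φ _ _ i).trans ?_
    rw [hφ, hφ]
    rfl
  rw [h]
  exact linearIndependent_basicBrackets_neg

theorem gradedIsomorphic_cartanGrading : GradedIsomorphic (freeNilpotentGrading ℂ 2 3)
    (negativeGrading isKGrading_cartanGrading) := by
  set N := negativePart isKGrading_cartanGrading with hN
  obtain ⟨φ, hφ⟩ := exists_lift_negativePart (r := 2) ![subX, subY]
  set x := freeNilpotentGen ℂ 2 3 0 with hx
  set y := freeNilpotentGen ℂ 2 3 1 with hy
  have hφx : (φ x : LieAlgebra.g₂ ℂ) = negX := congrArg Subtype.val (hφ 0)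
  have hφy : (φ y : LieAlgebra.g₂ ℂ) = negY := congrArg Subtype.val (hφ 1)
  have hbr : ∀ a b, (φ ⁅a, b⁆ : LieAlgebra.g₂ ℂ) =
      ⁅(φ a : LieAlgebra.g₂ ℂ), (φ b : LieAlgebra.g₂ ℂ)⁆ :=
    fun a b => by rw [LieHom.map_lie, LieSubalgebra.coe_bracket]
  -- Lifting root vectors together with their degree serves both surjectivity and the equality of
  -- graded components.
  have hpre : ∀ k, gDeg 1 0 k < 0 → ∃ z ∈ freeNilpotentGrading ℂ 2 3 (gDeg 1 0 k),
      (φ z : LieAlgebra.g₂ ℂ) = gBasis k := by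
    intro k hk
    refine gBasis_neg_induction (p := fun i v => ∃ z ∈ freeNilpotentGrading ℂ 2 3 i,
      (φ z : LieAlgebra.g₂ ℂ) = v) ?_ ?_ ?_ ?_ ?_ hk
    · exact ⟨x, Submodule.subset_span ⟨0, rfl⟩, hφx⟩
    · exact ⟨y, Submodule.subset_span ⟨1, rfl⟩, hφy⟩
    · exact ⟨⁅x, y⁆, freeNilpotentDegree_two_mem 0 1, by rw [hbr, hφx, hφy]⟩
    · exact ⟨⁅x, ⁅x, y⁆⁆, freeNilpotentDegree_three_mem 0 0 1, by rw [hbr, hbr, hφx, hφy]⟩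
    · exact ⟨-⁅y, ⁅x, y⁆⁆, neg_mem (freeNilpotentDegree_three_mem 1 0 1), by
        rw [map_neg, NegMemClass.coe_neg, hbr, hbr, hφx, hφy]⟩
  have hle : ∀ i : ℤ, i < 0 → cartanGrading i ≤
      (freeNilpotentGrading ℂ 2 3 i).map (N.toSubmodule.subtype ∘ₗ
        (φ : FreeNilpotent ℂ 2 3 →ₗ[ℂ] N)) := by
    intro i hi
    refine cartanGrading_le fun k hk => ?_
    subst hk
    obtain ⟨z, hz, hzk⟩ := hpre k hi
    exact ⟨z, hz, hzk⟩
  have hinj : Function.Injective φ := by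
    let b := Module.Basis.mk linearIndependent_basicBrackets_free span_basicBrackets.ge
    have hb : ∀ i, φ (b i) = basicBrackets subX subY i := fun i => by
      rw [Module.Basis.mk_apply, map_basicBrackets, hφ, hφ]
      rfl
    rw [injective_iff_map_eq_zero]
    intro z hz
    rw [← b.sum_repr z, map_sum] at hz
    simp only [map_smul, hb] at hz
    have := Fintype.linearIndependent_iff.mp linearIndependent_basicBrackets_neg _ hz
    rw [← b.sum_repr z]
    exact Finset.sum_eq_zero fun i _ => by rw [this i, zero_smul]
  have hsurj : Function.Surjective φ := by
    rintro ⟨n, hn⟩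
    have : (negativePart isKGrading_cartanGrading).toSubmodule ≤
        LinearMap.range (N.toSubmodule.subtype ∘ₗ (φ : FreeNilpotent ℂ 2 3 →ₗ[ℂ] N)) := by
      refine iSup_le fun i => (hle i i.2).trans ?_
      exact LinearMap.map_le_range
    obtain ⟨z, hz⟩ := this hn
    exact ⟨z, Subtype.ext hz⟩
  refine ⟨LieEquiv.ofBijective φ ⟨hinj, hsurj⟩, fun i => ?_⟩
  rcases lt_or_ge i 0 with hi | hi
  · obtain ⟨n, rfl⟩ : ∃ n : ℕ, i = -((n + 1 : ℕ) : ℤ) := ⟨(-i - 1).toNat, by lia⟩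
    have hto : (- -((n + 1 : ℕ) : ℤ)).toNat = n + 1 := by lia
    apply le_antisymm
    · rintro _ ⟨z, hz, rfl⟩
      rw [mem_negativeGrading _ hi]
      refine map_freeNilpotentDegree_le isKGrading_cartanGrading φ ?_ n z ?_
      · intro j
        rw [hφ]
        fin_cases j
        exacts [negX_mem, negY_mem]
      · rwa [SetLike.mem_coe, freeNilpotentGrading, hto] at hz
    · intro v hv
      rw [mem_negativeGrading _ hi] at hv
      obtain ⟨z, hz, hzv⟩ := hle _ hi hv
      exact ⟨z, hz, Subtype.ext hzv⟩
  · have hto : (-i).toNat = 0 := by lia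
    rw [freeNilpotentGrading, hto, negativeGrading, if_neg (not_lt.mpr hi), freeNilpotentDegree,
      Submodule.map_bot]

/-! ### Degrees and dimensions in a grading -/

section Generic

variable {R L : Type*} [CommRing R] [LieRing L] [LieAlgebra R L] {k : ℕ} {𝔫 : ℤ → Submodule R L}

theorem IsKGrading.iSup_eq_top (h : IsKGrading k 𝔫) : ⨆ i, 𝔫 i = ⊤ :=
  h.isInternal.submodule_iSup_eq_top

theorem IsKGrading.lie_mem (h : IsKGrading k 𝔫) {i j l : ℤ} (hl : i + j = l) {x y : L}
    (hx : x ∈ 𝔫 i) (hy : y ∈ 𝔫 j) : ⁅x, y⁆ ∈ 𝔫 l := by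
  subst hl; exact h.gradedBracket.bracket_mem hx hy

theorem IsKGrading.lie_eq_zero (h : IsKGrading k 𝔫) {i j : ℤ} (hl : (k : ℤ) < |i + j|) {x y : L}
    (hx : x ∈ 𝔫 i) (hy : y ∈ 𝔫 j) : ⁅x, y⁆ = 0 := by
  have := h.lie_mem rfl hx hy
  rwa [h.eq_bot _ hl, Submodule.mem_bot] at this

theorem IsKGrading.rootVec_mem {𝔫 : ℤ → Submodule ℂ (LieAlgebra.g₂ ℂ)} (h : IsKGrading k 𝔫)
    {p q : ℤ} {x y : LieAlgebra.g₂ ℂ} (hx : x ∈ 𝔫 p) (hy : y ∈ 𝔫 q) (i : Fin 6) :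
    SerreG2.rootVec x y i ∈ 𝔫 (p * SerreG2.coeffShort i + q * SerreG2.coeffLong i) := by
  have ha := h.lie_mem rfl hx hy
  have hb := h.lie_mem rfl hx ha
  have hc := h.lie_mem rfl hx hb
  have hd := h.lie_mem rfl hy hc
  fin_cases i
  · simpa [SerreG2.rootVec, SerreG2.coeffShort, SerreG2.coeffLong] using hx
  · simpa [SerreG2.rootVec, SerreG2.coeffShort, SerreG2.coeffLong] using hy
  · simpa [SerreG2.rootVec, SerreG2.coeffShort, SerreG2.coeffLong] using ha
  · change _ ∈ 𝔫 (p * 2 + q * 1)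
    rw [show p * 2 + q * 1 = p + (p + q) by ring]
    exact hb
  · change _ ∈ 𝔫 (p * 3 + q * 1)
    rw [show p * 3 + q * 1 = p + (p + (p + q)) by ring]
    exact hc
  · change _ ∈ 𝔫 (p * 3 + q * 2)
    rw [show p * 3 + q * 2 = q + (p + (p + (p + q))) by ring]
    exact hd

theorem IsKGrading.sum_finrank {K L : Type*} [Field K] [LieRing L] [LieAlgebra K L]
    [FiniteDimensional K L] {𝔫 : ℤ → Submodule K L} (h : IsKGrading k 𝔫) :
    ∑ i ∈ Finset.Icc (-(k : ℤ)) k, Module.finrank K (𝔫 i) = Module.finrank K L := by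
  classical
  have hint : DirectSum.IsInternal (fun i : Finset.Icc (-(k : ℤ)) k => 𝔫 i) := by
    rw [DirectSum.isInternal_submodule_iff_iSupIndep_and_iSup_eq_top]
    refine ⟨h.isInternal.submodule_iSupIndep.comp Subtype.val_injective, ?_⟩
    rw [← top_le_iff, ← h.iSup_eq_top]
    refine iSup_le fun i => ?_
    by_cases hi : (k : ℤ) < |i|
    · rw [h.eq_bot i hi]; exact bot_le
    · rw [not_lt, abs_le, ← Finset.mem_Icc] at hi
      exact le_iSup (fun i : Finset.Icc (-(k : ℤ)) k => 𝔫 i) ⟨i, hi⟩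
  rw [← Finset.sum_coe_sort, ← Module.finrank_directSum]
  exact (LinearEquiv.ofBijective
    (DirectSum.coeLinearMap fun i : Finset.Icc (-(k : ℤ)) k => 𝔫 i) hint).finrank_eq

end Generic

/-! ### Duality under the Killing form -/

section Killing

variable {k : ℕ} {𝔫 : ℤ → Submodule ℂ (LieAlgebra.g₂ ℂ)} (h : IsKGrading k 𝔫)
include h

/-- The operator ad x ∘ ad y shifts degrees by i + j ≠ 0, so it is traceless. -/
theorem killingForm_eq_zero {i j : ℤ} (hij : i + j ≠ 0) {x y : LieAlgebra.g₂ ℂ} (hx : x ∈ 𝔫 i)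
    (hy : y ∈ 𝔫 j) : killingForm ℂ (LieAlgebra.g₂ ℂ) x y = 0 := by
  rw [LieModule.traceForm_apply_apply]
  refine LinearMap.trace_eq_zero_of_mapsTo_ne h.isInternal (fun l => i + (j + l)) ?_ ?_
  · intro l hl
    exact hij (by lia)
  · intro l z hz
    exact h.lie_mem rfl hx (h.lie_mem rfl hy hz)

theorem eq_zero_of_killingForm {i : ℤ} {x : LieAlgebra.g₂ ℂ} (hx : x ∈ 𝔫 i)
    (h0 : ∀ y ∈ 𝔫 (-i), killingForm ℂ (LieAlgebra.g₂ ℂ) x y = 0) : x = 0 := by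
  have key : ∀ y, killingForm ℂ (LieAlgebra.g₂ ℂ) x y = 0 := by
    intro y
    have hy : y ∈ ⨆ j, 𝔫 j := by rw [h.iSup_eq_top]; trivial
    induction hy using Submodule.iSup_induction' with
    | mem j y hy =>
      by_cases hj : j = -i
      · subst hj; exact h0 y hy
      · exact killingForm_eq_zero h (by lia) hx hy
    | zero => simp
    | add y z _ _ hy hz => rw [map_add, hy, hz, add_zero]
  exact (LieAlgebra.IsKilling.killingForm_nondegenerate ℂ (LieAlgebra.g₂ ℂ)).1 x key

theorem finrank_le_finrank_neg (i : ℤ) :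
    Module.finrank ℂ (𝔫 i) ≤ Module.finrank ℂ (𝔫 (-i)) := by
  let f : 𝔫 i →ₗ[ℂ] Module.Dual ℂ (𝔫 (-i)) :=
    (killingForm ℂ (LieAlgebra.g₂ ℂ)).compl₁₂ (𝔫 i).subtype (𝔫 (-i)).subtype
  have hf : Function.Injective f := by
    rw [injective_iff_map_eq_zero]
    intro x hx
    refine Subtype.ext (eq_zero_of_killingForm h x.2 fun y hy => ?_)
    exact LinearMap.congr_fun hx ⟨y, hy⟩
  exact (LinearMap.finrank_le_finrank_of_injective hf).trans_eq Subspace.dual_finrank_eq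

theorem finrank_eq_finrank_neg (i : ℤ) :
    Module.finrank ℂ (𝔫 i) = Module.finrank ℂ (𝔫 (-i)) :=
  le_antisymm (finrank_le_finrank_neg h i) (by
    have := finrank_le_finrank_neg h (-i)
    rwa [neg_neg] at this)

/-- The elements of degree `0` that commute with all elements of nonzero degree form an ideal. -/
def degreeZeroKernel : LieIdeal ℂ (LieAlgebra.g₂ ℂ) where
  carrier := {x | x ∈ 𝔫 0 ∧ ∀ j ≠ 0, ∀ y ∈ 𝔫 j, ⁅x, y⁆ = 0}
  add_mem' := fun {x y} hx hy => ⟨add_mem hx.1 hy.1, fun j hj z hz => by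
    rw [add_lie, hx.2 j hj z hz, hy.2 j hj z hz, add_zero]⟩
  zero_mem' := ⟨zero_mem _, fun _ _ z _ => zero_lie z⟩
  smul_mem' := fun c x hx => ⟨Submodule.smul_mem _ c hx.1, fun j hj z hz => by
    rw [smul_lie, hx.2 j hj z hz, smul_zero]⟩
  lie_mem := by
    intro a x hx
    change ⁅a, x⁆ ∈ 𝔫 0 ∧ ∀ j ≠ 0, ∀ y ∈ 𝔫 j, ⁅⁅a, x⁆, y⁆ = 0
    have ha : a ∈ ⨆ j, 𝔫 j := by rw [h.iSup_eq_top]; trivial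
    induction ha using Submodule.iSup_induction' with
    | mem j a ha =>
      by_cases hj : j = 0
      · subst hj
        refine ⟨h.lie_mem rfl ha hx.1, fun j hj y hy => ?_⟩
        rw [lie_lie, hx.2 j hj y hy, hx.2 j hj _ (h.lie_mem (zero_add j) ha hy)]
        simp
      · rw [← lie_skew, hx.2 j hj a ha]
        simp
    | zero => simp
    | add a b _ _ ha hb =>
      rw [add_lie]
      exact ⟨add_mem ha.1 hb.1, fun j hj y hy => by
        rw [add_lie, ha.2 j hj y hy, hb.2 j hj y hy, add_zero]⟩

theorem disjoint_of_ne {i j : ℤ} (hij : i ≠ j) {x : LieAlgebra.g₂ ℂ} (hi : x ∈ 𝔫 i)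
    (hj : x ∈ 𝔫 j) : x = 0 :=
  Submodule.disjoint_def.mp (h.isInternal.submodule_iSupIndep.pairwiseDisjoint hij) x hi hj

theorem degreeZeroKernel_eq_bot (hk : k ≠ 0) : degreeZeroKernel h = ⊥ := by
  refine (g₂_eq_bot_or_eq_top _).resolve_right fun ht => h.ne_bot ?_
  rw [Submodule.eq_bot_iff]
  intro x hx
  have h0 : x ∈ degreeZeroKernel h := by rw [ht]; trivial
  exact disjoint_of_ne h (by lia) hx h0.1

/-- Annihilating `𝔫 (-1)` means annihilating the negative part it generates, and then by invariance
of the Killing form the positive part; such elements form a proper ideal. -/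
theorem eq_zero_of_lie_eq_zero (hk : k ≠ 0) {A : LieAlgebra.g₂ ℂ} (hA : A ∈ 𝔫 0)
    (h1 : ∀ x ∈ 𝔫 (-1), ⁅A, x⁆ = 0) : A = 0 := by
  have hneg : ∀ j < 0, ∀ y ∈ 𝔫 j, ⁅A, y⁆ = 0 := by
    intro j hj y hy
    have hy' := h.generated j hj hy
    rw [LieSubalgebra.mem_toSubmodule] at hy'
    clear hy
    induction hy' using LieSubalgebra.lieSpan_induction with
    | mem x hx => exact h1 x hx
    | zero => simp
    | add x y _ _ h1 h2 => rw [lie_add, h1, h2, add_zero]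
    | smul a x _ h => rw [lie_smul, h, smul_zero]
    | lie x y _ _ h1 h2 => rw [leibniz_lie, h1, h2, zero_lie, lie_zero, add_zero]
  have hmem : A ∈ degreeZeroKernel h := by
    refine ⟨hA, fun j hj y hy => ?_⟩
    rcases lt_or_gt_of_ne hj with hj | hj
    · exact hneg j hj y hy
    · refine eq_zero_of_killingForm h (h.lie_mem (zero_add j) hA hy) fun z hz => ?_
      rw [LieModule.traceForm_apply_lie_apply', hneg (-j) (by lia) z hz, map_zero, neg_zero]
  rwa [degreeZeroKernel_eq_bot h hk, LieSubmodule.mem_bot] at hmem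

end Killing

/-! ### Serre generators from a free negative part -/

/-- Two elements `v`, `w` of degree `-1` that freely generate the negative part of a `|3|`-grading
of `𝔤₂` as a `3`-step nilpotent Lie algebra. -/
structure IsFreePair (𝔫 : ℤ → Submodule ℂ (LieAlgebra.g₂ ℂ)) (v w : LieAlgebra.g₂ ℂ) : Prop where
  grading : IsKGrading 3 𝔫
  span_one : 𝔫 (-1) = Submodule.span ℂ {v, w}
  span_two : 𝔫 (-2) = Submodule.span ℂ {⁅v, w⁆}
  span_three : 𝔫 (-3) = Submodule.span ℂ {⁅v, ⁅v, w⁆⁆, ⁅w, ⁅v, w⁆⁆}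
  indep_one : LinearIndependent ℂ ![v, w]
  indep_two : ⁅v, w⁆ ≠ 0
  indep_three : LinearIndependent ℂ ![⁅v, ⁅v, w⁆⁆, ⁅w, ⁅v, w⁆⁆]

namespace IsFreePair

variable {𝔫 : ℤ → Submodule ℂ (LieAlgebra.g₂ ℂ)} {v w : LieAlgebra.g₂ ℂ} (h : IsFreePair 𝔫 v w)
include h

theorem v_mem : v ∈ 𝔫 (-1) := by rw [h.span_one]; exact Submodule.subset_span (by simp)

theorem w_mem : w ∈ 𝔫 (-1) := by rw [h.span_one]; exact Submodule.subset_span (by simp)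

theorem exists_coeff {x : LieAlgebra.g₂ ℂ} (hx : x ∈ 𝔫 (-1)) : ∃ a b : ℂ, a • v + b • w = x := by
  rwa [h.span_one, Submodule.mem_span_pair] at hx

theorem finrank_neg_one : Module.finrank ℂ (𝔫 (-1)) = 2 := by
  have := finrank_span_eq_card h.indep_one
  rwa [Matrix.range_cons_cons_empty, ← h.span_one, Fintype.card_fin] at this

theorem finrank_neg_two : Module.finrank ℂ (𝔫 (-2)) = 1 := by
  rw [h.span_two, finrank_span_singleton h.indep_two]

theorem finrank_neg_three : Module.finrank ℂ (𝔫 (-3)) = 2 := by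
  have := finrank_span_eq_card h.indep_three
  rwa [Matrix.range_cons_cons_empty, ← h.span_three, Fintype.card_fin] at this

theorem finrank_zero : Module.finrank ℂ (𝔫 0) = 4 := by
  have h1 := h.grading.sum_finrank
  have h2 : Finset.Icc (-((3 : ℕ) : ℤ)) ((3 : ℕ) : ℤ) = {-3, -2, -1, 0, 1, 2, 3} := by decide
  rw [h2, finrank_g₂, Finset.sum_insert (by decide), Finset.sum_insert (by decide),
    Finset.sum_insert (by decide), Finset.sum_insert (by decide), Finset.sum_insert (by decide),
    Finset.sum_insert (by decide), Finset.sum_singleton, finrank_eq_finrank_neg h.grading 1,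
    finrank_eq_finrank_neg h.grading 2, finrank_eq_finrank_neg h.grading 3, h.finrank_neg_one,
    h.finrank_neg_two, h.finrank_neg_three] at h1
  omega

theorem ext_zero {A B : LieAlgebra.g₂ ℂ} (hA : A ∈ 𝔫 0) (hB : B ∈ 𝔫 0) (hv : ⁅A, v⁆ = ⁅B, v⁆)
    (hw : ⁅A, w⁆ = ⁅B, w⁆) : A = B := by
  rw [← sub_eq_zero]
  refine eq_zero_of_lie_eq_zero h.grading (by norm_num) (sub_mem hA hB) fun x hx => ?_
  obtain ⟨a, b, rfl⟩ := h.exists_coeff hx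
  rw [sub_lie, lie_add, lie_add, lie_smul, lie_smul, lie_smul, lie_smul, hv, hw, sub_self]

/-- Faithfulness makes evaluation at v and w injective on `𝔫 0`, and both sides have dimension 4: `𝔫
0` is the full 𝔤𝔩(`𝔫 (-1)`). -/
theorem exists_zero {s t : LieAlgebra.g₂ ℂ} (hs : s ∈ 𝔫 (-1)) (ht : t ∈ 𝔫 (-1)) :
    ∃ A ∈ 𝔫 0, ⁅A, v⁆ = s ∧ ⁅A, w⁆ = t := by
  let f : 𝔫 0 →ₗ[ℂ] 𝔫 (-1) × 𝔫 (-1) :=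
    { toFun := fun A => (⟨⁅(A : LieAlgebra.g₂ ℂ), v⁆, h.grading.lie_mem (by norm_num) A.2 h.v_mem⟩,
        ⟨⁅(A : LieAlgebra.g₂ ℂ), w⁆, h.grading.lie_mem (by norm_num) A.2 h.w_mem⟩)
      map_add' := fun A B => by simp
      map_smul' := fun c A => by simp }
  have hf : Function.Injective f := by
    intro A B hAB
    simp only [f, LinearMap.coe_mk, AddHom.coe_mk, Prod.mk.injEq, Subtype.mk.injEq] at hAB
    exact Subtype.ext (h.ext_zero A.2 B.2 hAB.1 hAB.2)
  rw [LinearMap.injective_iff_surjective_of_finrank_eq_finrank (by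
    rw [Module.finrank_prod, h.finrank_zero, h.finrank_neg_one])] at hf
  obtain ⟨A, hA⟩ := hf (⟨s, hs⟩, ⟨t, ht⟩)
  simp only [f, LinearMap.coe_mk, AddHom.coe_mk, Prod.mk.injEq, Subtype.mk.injEq] at hA
  exact ⟨A, A.2, hA.1, hA.2⟩

/-- Every element of `𝔫 (-1)` is ⁅A, v⁆ with A of degree 0, so by invariance the Killing pairing of
d with `𝔫 (-1)` depends only on ⁅d, v⁆. -/
theorem ext_one {d e : LieAlgebra.g₂ ℂ} (hd : d ∈ 𝔫 1) (he : e ∈ 𝔫 1) (hv : ⁅d, v⁆ = ⁅e, v⁆) :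
    d = e := by
  rw [← sub_eq_zero]
  refine eq_zero_of_killingForm h.grading (sub_mem hd he) fun y hy => ?_
  obtain ⟨A, hA, rfl, -⟩ := h.exists_zero hy hy
  rw [← lie_skew, map_neg, ← LieModule.traceForm_apply_lie_apply, sub_lie, hv, sub_self]
  simp

/-- The action of an element of degree `1` on the elements of degree `-1`. -/
theorem exists_coeff_one {e : LieAlgebra.g₂ ℂ} (he : e ∈ 𝔫 1) : ∃ p q : ℂ,
    ⁅⁅e, v⁆, v⁆ = (2 * p) • v ∧ ⁅⁅e, v⁆, w⁆ = (3 * q) • v + (-p) • w ∧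
    ⁅⁅e, w⁆, v⁆ = (-q) • v + (3 * p) • w ∧ ⁅⁅e, w⁆, w⁆ = (2 * q) • w := by
  have G := h.grading
  have hu : ⁅v, w⁆ ∈ 𝔫 (-2) := G.lie_mem (by norm_num) h.v_mem h.w_mem
  have hP : ⁅v, ⁅v, w⁆⁆ ∈ 𝔫 (-3) := G.lie_mem (by norm_num) h.v_mem hu
  have hQ : ⁅w, ⁅v, w⁆⁆ ∈ 𝔫 (-3) := G.lie_mem (by norm_num) h.w_mem hu
  have hA : ⁅e, v⁆ ∈ 𝔫 0 := G.lie_mem (by norm_num) he h.v_mem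
  have hB : ⁅e, w⁆ ∈ 𝔫 0 := G.lie_mem (by norm_num) he h.w_mem
  have hwv : ⁅w, v⁆ = -⁅v, w⁆ := (lie_skew w v).symm
  obtain ⟨a₁, a₂, hAv⟩ := h.exists_coeff (G.lie_mem (by norm_num) hA h.v_mem)
  obtain ⟨a₃, a₄, hAw⟩ := h.exists_coeff (G.lie_mem (by norm_num) hA h.w_mem)
  obtain ⟨b₁, b₂, hBv⟩ := h.exists_coeff (G.lie_mem (by norm_num) hB h.v_mem)
  obtain ⟨b₃, b₄, hBw⟩ := h.exists_coeff (G.lie_mem (by norm_num) hB h.w_mem)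
  have hvB : ⁅v, ⁅e, w⁆⁆ = -⁅⁅e, w⁆, v⁆ := (lie_skew _ _).symm
  have hAu : ⁅⁅e, v⁆, ⁅v, w⁆⁆ = (a₁ + a₄) • ⁅v, w⁆ := by
    rw [leibniz_lie, ← hAv, ← hAw, add_lie, lie_add, smul_lie, smul_lie, lie_smul, lie_smul,
      lie_self, lie_self]
    module
  have hBu : ⁅⁅e, w⁆, ⁅v, w⁆⁆ = (b₁ + b₄) • ⁅v, w⁆ := by
    rw [leibniz_lie, ← hBv, ← hBw, add_lie, lie_add, smul_lie, smul_lie, lie_smul, lie_smul,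
      lie_self, lie_self]
    module
  have heu : ⁅e, ⁅v, w⁆⁆ = (a₃ - b₁) • v + (a₄ - b₂) • w := by
    rw [leibniz_lie, hvB, ← hAw, ← hBv]
    module
  have heP : ⁅e, ⁅v, ⁅v, w⁆⁆⁆ = (a₁ + 2 * a₄ - b₂) • ⁅v, w⁆ := by
    rw [leibniz_lie e v, hAu, heu, lie_add, lie_smul, lie_smul, lie_self]
    module
  have heQ : ⁅e, ⁅w, ⁅v, w⁆⁆⁆ = (2 * b₁ + b₄ - a₃) • ⁅v, w⁆ := by
    rw [leibniz_lie e w, hBu, heu, lie_add, lie_smul, lie_smul, lie_self, hwv]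
    module
  have hind : ∀ s t : ℂ, s • ⁅v, ⁅v, w⁆⁆ + t • ⁅w, ⁅v, w⁆⁆ = 0 → s = 0 ∧ t = 0 :=
    fun s t hst => LinearIndependent.pair_iff.mp h.indep_three s t hst
  -- Brackets of degree -4 vanish; applying ad e to three of them and comparing coefficients in
  -- degree -3 gives the linear equations `c1`, `c2`, `c3`.
  have c1 : a₂ = 0 ∧ 3 * a₁ + 3 * a₄ = b₂ := by
    have z : ⁅e, ⁅v, ⁅v, ⁅v, w⁆⁆⁆⁆ = 0 := by
      rw [G.lie_eq_zero (by norm_num) h.v_mem hP, lie_zero]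
    rw [leibniz_lie e v, leibniz_lie _ v, ← hAv, hAu, heP, add_lie, smul_lie, smul_lie, lie_smul,
      lie_smul] at z
    have := hind (3 * a₁ + 3 * a₄ - b₂) a₂ (by rw [← z]; module)
    exact ⟨this.2, sub_eq_zero.mp this.1⟩
  have c2 : a₁ + 2 * a₄ = 0 ∧ 2 * b₁ + b₄ = 0 := by
    have z : ⁅e, ⁅v, ⁅w, ⁅v, w⁆⁆⁆⁆ = 0 := by
      rw [G.lie_eq_zero (by norm_num) h.v_mem hQ, lie_zero]
    rw [leibniz_lie e v, leibniz_lie _ w, ← hAw, hAu, heQ, add_lie, smul_lie, smul_lie, lie_smul,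
      lie_smul] at z
    have := hind (2 * b₁ + b₄) (a₁ + 2 * a₄) (by rw [← z]; module)
    exact ⟨this.2, this.1⟩
  have c3 : b₃ = 0 ∧ 3 * b₁ + 3 * b₄ = a₃ := by
    have z : ⁅e, ⁅w, ⁅w, ⁅v, w⁆⁆⁆⁆ = 0 := by
      rw [G.lie_eq_zero (by norm_num) h.w_mem hQ, lie_zero]
    rw [leibniz_lie e w, leibniz_lie _ w, ← hBw, hBu, heQ, add_lie, smul_lie, smul_lie, lie_smul,
      lie_smul] at z
    have := hind b₃ (3 * b₁ + 3 * b₄ - a₃) (by rw [← z]; module)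
    exact ⟨this.1, sub_eq_zero.mp this.2⟩
  refine ⟨-a₄, -b₁, ?_, ?_, ?_, ?_⟩
  · rw [← hAv, c1.1, zero_smul, add_zero]
    congr 1
    linear_combination c2.1
  · rw [← hAw, ← c3.2]
    congr 2
    · linear_combination 3 * c2.2
    · ring
  · rw [← hBv, ← c1.2]
    congr 2
    · ring
    · linear_combination 3 * c2.1
  · rw [← hBw, c3.1, zero_smul, zero_add]
    congr 1
    linear_combination c2.2

theorem v_ne_zero : v ≠ 0 := by
  have := h.indep_one.ne_zero 0
  simpa using this

/-- There is an element of degree `1` that spans an `𝔰𝔩₂` together with `v`. -/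
theorem exists_one : ∃ e ∈ 𝔫 1, ⁅⁅e, v⁆, v⁆ = (-2 : ℂ) • v ∧ ⁅⁅e, v⁆, w⁆ = w ∧
    ⁅⁅e, w⁆, v⁆ = (-3 : ℂ) • w ∧ ⁅⁅e, w⁆, w⁆ = 0 := by
  have G := h.grading
  have hm : ∀ {e x}, e ∈ 𝔫 1 → x ∈ 𝔫 (-1) → ⁅⁅e, x⁆, x⁆ ∈ 𝔫 (-1) := fun he hx =>
    G.lie_mem (by norm_num : (0 : ℤ) + -1 = -1) (G.lie_mem (by norm_num) he hx) hx
  -- By `exists_coeff_one` this map sends e to 2p v + 2q w, so it reads off both parameters at once;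
  -- the preimage of -2v has p = -1 and q = 0.
  let f : 𝔫 1 →ₗ[ℂ] 𝔫 (-1) :=
    { toFun := fun e => ⟨⁅⁅(e : LieAlgebra.g₂ ℂ), v⁆, v⁆ + ⁅⁅(e : LieAlgebra.g₂ ℂ), w⁆, w⁆,
        add_mem (hm e.2 h.v_mem) (hm e.2 h.w_mem)⟩
      map_add' := fun A B => by
        simp only [Subtype.ext_iff, Submodule.coe_add, add_lie]
        abel
      map_smul' := fun c A => Subtype.ext (by
        simp only [Submodule.coe_smul, smul_lie, smul_add, RingHom.id_apply]) }
  have hf : Function.Injective f := by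
    rw [injective_iff_map_eq_zero]
    intro e he
    have he' : ⁅⁅(e : LieAlgebra.g₂ ℂ), v⁆, v⁆ + ⁅⁅(e : LieAlgebra.g₂ ℂ), w⁆, w⁆ = 0 :=
      congrArg Subtype.val he
    obtain ⟨p, q, h1, h2, h3, h4⟩ := h.exists_coeff_one e.2
    rw [h1, h4] at he'
    have hpq := LinearIndependent.pair_iff.mp h.indep_one _ _ he'
    have hp : p = 0 := by simpa using hpq.1
    have hq : q = 0 := by simpa using hpq.2
    subst hp hq
    refine Subtype.ext (h.ext_one e.2 (zero_mem _) ?_)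
    refine h.ext_zero (G.lie_mem (by norm_num) e.2 h.v_mem) (by simp) ?_ ?_
    · rw [h1]; simp
    · rw [h2]; simp
  rw [LinearMap.injective_iff_surjective_of_finrank_eq_finrank
    (finrank_eq_finrank_neg G 1)] at hf
  obtain ⟨e, he⟩ := hf ⟨(-2 : ℂ) • v, Submodule.smul_mem _ _ h.v_mem⟩
  have he' : ⁅⁅(e : LieAlgebra.g₂ ℂ), v⁆, v⁆ + ⁅⁅(e : LieAlgebra.g₂ ℂ), w⁆, w⁆ = (-2 : ℂ) • v :=
    congrArg Subtype.val he
  obtain ⟨p, q, h1, h2, h3, h4⟩ := h.exists_coeff_one e.2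
  rw [h1, h4] at he'
  have hpq := LinearIndependent.pair_iff.mp h.indep_one (2 * p + 2) (2 * q)
    (by rw [add_smul, add_right_comm, he']; module)
  have hp : p = -1 := by linear_combination hpq.1 / 2
  have hq : q = 0 := by simpa using hpq.2
  subst hp hq
  refine ⟨e, e.2, ?_, ?_, ?_, ?_⟩
  · rw [h1]; norm_num
  · rw [h2]; norm_num
  · rw [h3]; norm_num
  · rw [h4]; norm_num

/-- Serre generators of `𝔤₂` adapted to the grading. -/
theorem exists_serreG2 : ∃ e₀ ∈ 𝔫 1, ∃ e₁ ∈ 𝔫 0, ∃ f₁ ∈ 𝔫 0, ∃ h₀ ∈ 𝔫 0, ∃ h₁ ∈ 𝔫 0,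
    SerreG2 e₀ e₁ v f₁ h₀ h₁ := by
  have G := h.grading
  obtain ⟨e, he, hvv, hvw, hwv, hww⟩ := h.exists_one
  -- E and F are the elementary matrices w ↦ v and v ↦ w. Then H = ⁅e, v⁆ and K = ⁅E, F⁆ act on (v,
  -- w) as diag(-2, 1) and diag(1, -1), and degree 0 relations reduce to 2 × 2 matrices.
  obtain ⟨E, hE, hEv, hEw⟩ := h.exists_zero (zero_mem _) h.v_mem
  obtain ⟨F, hF, hFv, hFw⟩ := h.exists_zero h.w_mem (zero_mem _)
  have m0 : ∀ {x y}, x ∈ 𝔫 0 → y ∈ 𝔫 0 → ⁅x, y⁆ ∈ 𝔫 0 := fun hx hy => G.lie_mem (by norm_num) hx hy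
  have m1 : ∀ {x y}, x ∈ 𝔫 0 → y ∈ 𝔫 1 → ⁅x, y⁆ ∈ 𝔫 1 := fun hx hy => G.lie_mem (by norm_num) hx hy
  have hH : ⁅e, v⁆ ∈ 𝔫 0 := G.lie_mem (by norm_num) he h.v_mem
  have hK : ⁅E, F⁆ ∈ 𝔫 0 := m0 hE hF
  have hKv : ⁅⁅E, F⁆, v⁆ = v := by rw [lie_lie, hFv, hEv, hEw, lie_zero, sub_zero]
  have hKw : ⁅⁅E, F⁆, w⁆ = -w := by rw [lie_lie, hFw, hEw, hFv, lie_zero, zero_sub]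
  have hew : ⁅e, w⁆ = (-3 : ℂ) • F := by
    refine h.ext_zero (G.lie_mem (by norm_num) he h.w_mem) (Submodule.smul_mem _ _ hF) ?_ ?_
    · rw [hwv, smul_lie, hFv]
    · rw [hww, smul_lie, hFw, smul_zero]
  generalize hHe : ⁅e, v⁆ = H at *
  generalize hKe : ⁅E, F⁆ = K at *
  have hHE : ⁅H, E⁆ = (-3 : ℂ) • E := by
    refine h.ext_zero (m0 hH hE) (Submodule.smul_mem _ _ hE) ?_ ?_
    · simp [lie_lie, hvv, hEv]
    · rw [lie_lie, hEw, hvv, hvw, hEw, smul_lie, hEw]; module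
  have hHF : ⁅H, F⁆ = (3 : ℂ) • F := by
    refine h.ext_zero (m0 hH hF) (Submodule.smul_mem _ _ hF) ?_ ?_
    · rw [lie_lie, hFv, hvv, hvw, lie_smul, smul_lie, hFv]; module
    · simp [lie_lie, hvw, hFw]
  have hKE : ⁅K, E⁆ = (2 : ℂ) • E := by
    refine h.ext_zero (m0 hK hE) (Submodule.smul_mem _ _ hE) ?_ ?_
    · simp [lie_lie, hKv, hEv]
    · rw [lie_lie, hEw, hKv, hKw, lie_neg, smul_lie, hEw]; module
  have hKF : ⁅K, F⁆ = (-2 : ℂ) • F := by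
    refine h.ext_zero (m0 hK hF) (Submodule.smul_mem _ _ hF) ?_ ?_
    · rw [lie_lie, hFv, hKv, hKw, smul_lie, hFv]; module
    · simp [lie_lie, hKw, hFw]
  have hHK : ⁅H, K⁆ = 0 := by
    refine h.ext_zero (m0 hH hK) (zero_mem _) ?_ ?_
    · rw [lie_lie, hKv, hvv, lie_smul, hKv]; simp
    · rw [lie_lie, hKw, hvw, lie_neg, hvw, hKw]; simp
  have hFH : ⁅F, H⁆ = (-3 : ℂ) • F := by rw [← lie_skew, hHF]; module
  have hEH : ⁅E, H⁆ = (3 : ℂ) • E := by rw [← lie_skew, hHE]; module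
  have hFe : ⁅F, e⁆ = 0 := by
    refine h.ext_one (m1 hF he) (zero_mem _) ?_
    rw [lie_lie, hHe, hFH, hFv, hew]; simp
  have hEEe : ⁅E, ⁅E, e⁆⁆ = 0 := by
    refine h.ext_one (m1 hE (m1 hE he)) (zero_mem _) ?_
    have h1 : ⁅⁅E, e⁆, v⁆ = (3 : ℂ) • E := by rw [lie_lie, hHe, hEH, hEv, lie_zero, sub_zero]
    rw [lie_lie, h1, hEv, lie_smul]; simp
  refine ⟨e, he, E, hE, F, hF, H, hH, K, hK, ?_⟩
  exact
    { hh := hHK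
      ef00 := hHe
      ef11 := hKe
      ef01 := by rw [← lie_skew, hFe, neg_zero]
      ef10 := hEv
      he00 := by
        refine h.ext_one (m1 hH he) (Submodule.smul_mem _ _ he) ?_
        rw [lie_lie, hHe, hvv, lie_self, lie_smul, smul_lie, hHe]; module
      he01 := hHE
      he10 := by
        refine h.ext_one (m1 hK he) (Submodule.smul_mem _ _ he) ?_
        rw [lie_lie, hHe, hKv, ← lie_skew, hHK, smul_lie, hHe]; module
      he11 := hKE
      hf00 := hvv
      hf01 := hHF
      hf10 := by rw [hKv, one_smul]
      hf11 := hKF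
      e01 := by
        have k1 : ⁅e, E⁆ ∈ 𝔫 1 := G.lie_mem (by norm_num) he hE
        have k2 : ⁅e, ⁅e, E⁆⁆ ∈ 𝔫 2 := G.lie_mem (by norm_num) he k1
        have k3 : ⁅e, ⁅e, ⁅e, E⁆⁆⁆ ∈ 𝔫 3 := G.lie_mem (by norm_num) he k2
        exact G.lie_eq_zero (by norm_num) he k3
      e10 := hEEe
      f01 := by
        have k1 : ⁅v, F⁆ ∈ 𝔫 (-1) := G.lie_mem (by norm_num) h.v_mem hF
        have k2 : ⁅v, ⁅v, F⁆⁆ ∈ 𝔫 (-2) := G.lie_mem (by norm_num) h.v_mem k1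
        have k3 : ⁅v, ⁅v, ⁅v, F⁆⁆⁆ ∈ 𝔫 (-3) := G.lie_mem (by norm_num) h.v_mem k2
        exact G.lie_eq_zero (by norm_num) h.v_mem k3
      f10 := by rw [hFv, hFw] }

/-- The endomorphism given by the adapted generators is injective by simplicity, as v ≠ 0, and
surjective by dimension; it carries each root vector into `𝔫` of its Cartan degree. -/
theorem gradedIsomorphic : GradedIsomorphic 𝔫 cartanGrading := by
  have G := h.grading
  obtain ⟨e₀, he₀, e₁, he₁, f₁, hf₁, h₀, hh₀, h₁, hh₁, S⟩ := h.exists_serreG2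
  obtain ⟨θ, t1, t2, t3, t4, t5, t6⟩ := S.exists_lift
  have hinj : Function.Injective θ := by
    rw [← LieHom.ker_eq_bot]
    refine (g₂_eq_bot_or_eq_top _).resolve_right fun ht => h.v_ne_zero ?_
    have : gF 0 ∈ θ.ker := by rw [ht]; trivial
    rw [← t3]; exact LieHom.mem_ker.mp this
  have hsurj : Function.Surjective θ :=
    (LinearMap.injective_iff_surjective (f := (θ : _ →ₗ[ℂ] LieAlgebra.g₂ ℂ))).mp hinj
  have hroot : ∀ x y i, θ (SerreG2.rootVec x y i) = SerreG2.rootVec (θ x) (θ y) i := by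
    intro x y i
    fin_cases i <;> simp [SerreG2.rootVec]
  have hmem : ∀ k, θ (gBasis k) ∈ 𝔫 (gDeg 1 0 k) := by
    rintro ((k | k) | k)
    · have := G.rootVec_mem he₀ he₁ k
      rw [← t1, ← t2, ← hroot] at this
      exact this
    · have := G.rootVec_mem h.v_mem hf₁ k
      rw [← t3, ← t4, ← hroot] at this
      change θ (SerreG2.rootVec (gF 0) (gF 1) k) ∈
        𝔫 (-(1 * SerreG2.coeffShort k + 0 * SerreG2.coeffLong k))
      convert this using 2
      ring
    · fin_cases k
      · change θ (gH 0) ∈ 𝔫 0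
        rwa [t5]
      · change θ (gH 1) ∈ 𝔫 0
        rwa [t6]
  have hle : (fun i => (cartanGrading i).map (θ : _ →ₗ[ℂ] LieAlgebra.g₂ ℂ)) ≤ 𝔫 := by
    intro i
    refine Submodule.map_le_iff_le_comap.mpr (cartanGrading_le fun k hk => ?_)
    subst hk
    exact hmem k
  have htop : ⨆ i, (cartanGrading i).map (θ : _ →ₗ[ℂ] LieAlgebra.g₂ ℂ) = ⊤ := by
    rw [← Submodule.map_iSup, iSup_cartanGrading, Submodule.map_top]
    exact LinearMap.range_eq_top.mpr hsurj
  -- The images lie in the components of `𝔫` and together fill 𝔤₂, so independence of `𝔫` forces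
  -- equality.
  have heq := (G.isInternal.submodule_iSupIndep.le_iff_eq_of_iSup_eq_top htop).mp hle
  let Θ := LieEquiv.ofBijective θ ⟨hinj, hsurj⟩
  refine ⟨Θ.symm, fun i => ?_⟩
  rw [← congrFun heq i]
  ext x
  constructor
  · rintro ⟨_, ⟨y, hy, rfl⟩, rfl⟩
    have : Θ.symm (θ y) = y := Θ.symm_apply_apply y
    exact this.symm ▸ hy
  · intro hx
    exact ⟨θ x, ⟨x, hx, rfl⟩, Θ.symm_apply_apply x⟩

end IsFreePair

/-! ### Low-degree components of the free algebra -/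

section Transport

variable {R L : Type*} [CommRing R] [LieRing L] [LieAlgebra R L] {k r : ℕ} {𝔫 : ℤ → Submodule R L}

theorem exists_embedding_of_gradedIsomorphic (h : IsKGrading k 𝔫)
    (hiso : GradedIsomorphic (freeNilpotentGrading R r k) (negativeGrading h)) :
    ∃ Φ : FreeNilpotent R r k →ₗ⁅R⁆ L, Function.Injective Φ ∧ ∀ n : ℕ,
      𝔫 (-((n + 1 : ℕ) : ℤ)) =
        (freeNilpotentDegree R r k (n + 1)).map (Φ : FreeNilpotent R r k →ₗ[R] L) := by
  obtain ⟨φ, hφ⟩ := hiso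
  refine ⟨(negativePart h).incl.comp φ.toLieHom, Subtype.val_injective.comp φ.injective,
    fun n => ?_⟩
  have hn : -((n + 1 : ℕ) : ℤ) < 0 := by lia
  have hto : (- -((n + 1 : ℕ) : ℤ)).toNat = n + 1 := by lia
  have h1 := hφ (-((n + 1 : ℕ) : ℤ))
  rw [freeNilpotentGrading, hto] at h1
  ext x
  constructor
  · intro hx
    have h2 : (⟨x, mem_negativePart h hn hx⟩ : negativePart h) ∈
        negativeGrading h (-((n + 1 : ℕ) : ℤ)) := (mem_negativeGrading h hn).mpr hx
    rw [← h1] at h2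
    obtain ⟨y, hy, hyx⟩ := h2
    exact ⟨y, hy, congrArg Subtype.val hyx⟩
  · rintro ⟨y, hy, rfl⟩
    have h2 : φ y ∈ negativeGrading h (-((n + 1 : ℕ) : ℤ)) := by
      rw [← h1]
      exact ⟨y, hy, rfl⟩
    exact (mem_negativeGrading h hn).mp h2

theorem lie_eq_zero_of_mem_span {x : L} {s : Set L} (hs : ∀ y ∈ s, ⁅x, y⁆ = 0) {y : L}
    (hy : y ∈ Submodule.span R s) : ⁅x, y⁆ = 0 := by
  induction hy using Submodule.span_induction with
  | mem y hy => exact hs y hy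
  | zero => exact lie_zero x
  | add y z _ _ h1 h2 => rw [lie_add, h1, h2, add_zero]
  | smul a y _ h => rw [lie_smul, h, smul_zero]

theorem lie_left_combination (x y : L) (a b : R) : ⁅x, a • x + b • y⁆ = b • ⁅x, y⁆ := by
  rw [lie_add, lie_smul, lie_smul, lie_self, smul_zero, zero_add]

theorem lie_right_combination (x y : L) (a b : R) : ⁅y, a • x + b • y⁆ = -a • ⁅x, y⁆ := by
  rw [lie_add, lie_smul, lie_smul, lie_self, smul_zero, add_zero, ← lie_skew x y, smul_neg,
    neg_smul, neg_neg]

theorem freeNilpotentDegree_eq_bot (hr : r ≤ 1) (n : ℕ) :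
    freeNilpotentDegree R r k (n + 2) = ⊥ := by
  have : Subsingleton (Fin r) := Fin.subsingleton_iff_le_one.mpr hr
  induction n with
  | zero =>
    rw [freeNilpotentDegree, Submodule.span_eq_bot]
    rintro _ ⟨j, y, hy, rfl⟩
    refine lie_eq_zero_of_mem_span (R := R) ?_ hy
    rintro _ ⟨i, rfl⟩
    rw [Subsingleton.elim i j]
    exact lie_self (L := FreeNilpotent R r k) _
  | succ n ih =>
    rw [freeNilpotentDegree, Submodule.span_eq_bot]
    rintro _ ⟨j, y, hy, rfl⟩
    rw [ih, Submodule.mem_bot] at hy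
    rw [hy]
    exact lie_zero (L := FreeNilpotent R r k) (M := FreeNilpotent R r k) _

theorem freeNilpotentDegree_one_two : freeNilpotentDegree R 2 k 1 =
    Submodule.span R {freeNilpotentGen R 2 k 0, freeNilpotentGen R 2 k 1} := by
  rw [freeNilpotentDegree]
  congr 1
  ext z
  simp [Fin.exists_fin_two, eq_comm]

theorem freeNilpotentDegree_two_two : freeNilpotentDegree R 2 k 2 =
    Submodule.span R {⁅freeNilpotentGen R 2 k 0, freeNilpotentGen R 2 k 1⁆} := by
  apply le_antisymm
  · rw [freeNilpotentDegree, Submodule.span_le]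
    rintro _ ⟨j, y, hy, rfl⟩
    rw [freeNilpotentDegree_one_two, Submodule.mem_span_pair] at hy
    obtain ⟨a, b, rfl⟩ := hy
    rw [SetLike.mem_coe, Submodule.mem_span_singleton]
    fin_cases j
    · exact ⟨b, (lie_left_combination _ _ a b).symm⟩
    · exact ⟨-a, (lie_right_combination _ _ a b).symm⟩
  · rw [Submodule.span_singleton_le_iff_mem]
    exact freeNilpotentDegree_two_mem 0 1

theorem freeNilpotentDegree_three_two : freeNilpotentDegree R 2 k 3 =
    Submodule.span R
      {⁅freeNilpotentGen R 2 k 0, ⁅freeNilpotentGen R 2 k 0, freeNilpotentGen R 2 k 1⁆⁆,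
      ⁅freeNilpotentGen R 2 k 1, ⁅freeNilpotentGen R 2 k 0, freeNilpotentGen R 2 k 1⁆⁆} := by
  apply le_antisymm
  · rw [freeNilpotentDegree, Submodule.span_le]
    rintro _ ⟨j, y, hy, rfl⟩
    rw [freeNilpotentDegree_two_two, Submodule.mem_span_singleton] at hy
    obtain ⟨a, rfl⟩ := hy
    have hj : ⁅freeNilpotentGen R 2 k j, a • ⁅freeNilpotentGen R 2 k 0, freeNilpotentGen R 2 k 1⁆⁆ =
        a • ⁅freeNilpotentGen R 2 k j, ⁅freeNilpotentGen R 2 k 0, freeNilpotentGen R 2 k 1⁆⁆ :=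
      lie_smul (L := FreeNilpotent R 2 k) (M := FreeNilpotent R 2 k) _ _ _
    rw [hj]
    refine Submodule.smul_mem _ _ (Submodule.subset_span ?_)
    fin_cases j <;> simp
  · rw [Submodule.span_le]
    rintro _ (rfl | rfl)
    exacts [freeNilpotentDegree_three_mem 0 0 1, freeNilpotentDegree_three_mem 1 0 1]

end Transport

/-! ### Determination of the rank -/

/-- Setting all generators but two equal to zero. -/
theorem exists_projection {r : ℕ} {i j : Fin r} (hij : i ≠ j) :
    ∃ φ : FreeNilpotent ℂ r 3 →ₗ⁅ℂ⁆ negativePart isKGrading_cartanGrading,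
      φ (freeNilpotentGen ℂ r 3 i) = subX ∧ φ (freeNilpotentGen ℂ r 3 j) = subY ∧
      ∀ l, l ≠ i → l ≠ j → φ (freeNilpotentGen ℂ r 3 l) = 0 := by
  obtain ⟨φ, hφ⟩ := exists_lift_negativePart
    (fun l : Fin r => if l = i then subX else if l = j then subY else 0)
  refine ⟨φ, ?_, ?_, fun l hi hj => ?_⟩
  · rw [hφ, if_pos rfl]
  · rw [hφ, if_neg hij.symm, if_pos rfl]
  · rw [hφ, if_neg hi, if_neg hj]

theorem basicBrackets_neg_pair {s : Fin 2 → Fin 5} (hs : Function.Injective s) {a b : ℂ}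
    (hab : a • basicBrackets subX subY (s 0) + b • basicBrackets subX subY (s 1) = 0) :
    a = 0 ∧ b = 0 := by
  have h := linearIndependent_basicBrackets_neg.comp s hs
  have := Fintype.linearIndependent_iff.mp h ![a, b] (by simpa [Fin.sum_univ_two] using hab)
  exact ⟨this 0, this 1⟩

/-- Projections to pairs of generators isolate the coefficients, which vanish by independence in the
two-generator model. -/
theorem linearIndependent_one {r : ℕ} {i j l : Fin r} (hij : i ≠ j) (hil : i ≠ l) (hjl : j ≠ l) :
    LinearIndependent ℂ ![freeNilpotentGen ℂ r 3 i, freeNilpotentGen ℂ r 3 j,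
      freeNilpotentGen ℂ r 3 l] := by
  rw [Fintype.linearIndependent_iff]
  intro g hg
  simp only [Fin.sum_univ_three, Matrix.cons_val_zero, Matrix.cons_val_one, Matrix.cons_val] at hg
  obtain ⟨φ, h1, h2, h3⟩ := exists_projection hij
  obtain ⟨ψ, k1, k2, k3⟩ := exists_projection hil
  have a := congrArg φ hg
  have b := congrArg ψ hg
  simp only [map_add, map_smul, map_zero, h1, h2, h3 l hil.symm hjl.symm, smul_zero, add_zero] at a
  simp only [map_add, map_smul, map_zero, k1, k2, k3 j hij.symm hjl, smul_zero, add_zero] at b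
  have a' := basicBrackets_neg_pair (s := ![0, 1]) (by decide) a
  have b' := basicBrackets_neg_pair (s := ![0, 1]) (by decide) b
  intro m
  fin_cases m
  exacts [a'.1, a'.2, b'.2]

theorem linearIndependent_two {r : ℕ} {i j l : Fin r} (hij : i ≠ j) (hil : i ≠ l) (hjl : j ≠ l) :
    LinearIndependent ℂ ![⁅freeNilpotentGen ℂ r 3 i, freeNilpotentGen ℂ r 3 j⁆,
      ⁅freeNilpotentGen ℂ r 3 i, freeNilpotentGen ℂ r 3 l⁆,
      ⁅freeNilpotentGen ℂ r 3 j, freeNilpotentGen ℂ r 3 l⁆] := by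
  rw [Fintype.linearIndependent_iff]
  intro g hg
  simp only [Fin.sum_univ_three, Matrix.cons_val_zero, Matrix.cons_val_one, Matrix.cons_val] at hg
  have hXY : ⁅subX, subY⁆ ≠ 0 := linearIndependent_basicBrackets_neg.ne_zero 2
  obtain ⟨φ, h1, h2, h3⟩ := exists_projection hij
  obtain ⟨ψ, k1, k2, k3⟩ := exists_projection hil
  obtain ⟨χ, m1, m2, m3⟩ := exists_projection hjl
  have a := congrArg φ hg
  have b := congrArg ψ hg
  have c := congrArg χ hg
  simp only [map_add, map_smul, map_zero, LieHom.map_lie, h1, h2, h3 l hil.symm hjl.symm, lie_zero,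
    smul_zero, add_zero, smul_eq_zero, hXY, or_false] at a
  simp only [map_add, map_smul, map_zero, LieHom.map_lie, k1, k2, k3 j hij.symm hjl, lie_zero,
    zero_lie, smul_zero, add_zero, zero_add, smul_eq_zero, hXY, or_false] at b
  simp only [map_add, map_smul, map_zero, LieHom.map_lie, m1, m2, m3 i hij hil,
    zero_lie, smul_zero, zero_add, smul_eq_zero, hXY, or_false] at c
  intro m
  fin_cases m
  exacts [a, b, c]

theorem linearIndependent_three {r : ℕ} {i j : Fin r} (hij : i ≠ j) :
    LinearIndependent ℂ
      ![⁅freeNilpotentGen ℂ r 3 i, ⁅freeNilpotentGen ℂ r 3 i, freeNilpotentGen ℂ r 3 j⁆⁆,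
      ⁅freeNilpotentGen ℂ r 3 j, ⁅freeNilpotentGen ℂ r 3 i, freeNilpotentGen ℂ r 3 j⁆⁆] := by
  rw [LinearIndependent.pair_iff]
  intro s t hst
  obtain ⟨φ, h1, h2, -⟩ := exists_projection hij
  have a := congrArg φ hst
  simp only [map_add, map_smul, map_zero, LieHom.map_lie, h1, h2] at a
  exact basicBrackets_neg_pair (s := ![3, 4]) (by decide) a

theorem card_le_finrank {n : ℕ} {K V W : Type*} [Field K] [AddCommGroup V] [Module K V]
    [AddCommGroup W] [Module K W] [FiniteDimensional K W] {f : V →ₗ[K] W}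
    (hf : Function.Injective f) {b : Fin n → V} (hb : LinearIndependent K b)
    {D : Submodule K V} (hD : ∀ i, b i ∈ D) : n ≤ Module.finrank K (D.map f) := by
  have h1 : LinearIndependent K (fun i => (⟨f (b i), b i, hD i, rfl⟩ : D.map f)) := by
    refine LinearIndependent.of_comp (D.map f).subtype ?_
    exact hb.map' f (LinearMap.ker_eq_bot_of_injective hf)
  simpa using h1.fintype_card_le_finrank

section Rank

variable {𝔫 : ℤ → Submodule ℂ (LieAlgebra.g₂ ℂ)}

theorem two_mul_finrank_le (h : IsKGrading 3 𝔫) :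
    2 * (Module.finrank ℂ (𝔫 (-1)) + Module.finrank ℂ (𝔫 (-2)) + Module.finrank ℂ (𝔫 (-3))) ≤
      14 := by
  have h1 := h.sum_finrank
  have h2 : Finset.Icc (-((3 : ℕ) : ℤ)) ((3 : ℕ) : ℤ) = {-3, -2, -1, 0, 1, 2, 3} := by decide
  rw [h2, finrank_g₂, Finset.sum_insert (by decide), Finset.sum_insert (by decide),
    Finset.sum_insert (by decide), Finset.sum_insert (by decide), Finset.sum_insert (by decide),
    Finset.sum_insert (by decide), Finset.sum_singleton, finrank_eq_finrank_neg h 1,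
    finrank_eq_finrank_neg h 2, finrank_eq_finrank_neg h 3] at h1
  omega

theorem rank_eq_two (h : IsKGrading 3 𝔫) {r : ℕ}
    (hiso : GradedIsomorphic (freeNilpotentGrading ℂ r 3) (negativeGrading h)) : r = 2 := by
  obtain ⟨Φ, hΦ, hmap⟩ := exists_embedding_of_gradedIsomorphic h hiso
  rcases Nat.lt_or_ge 1 r with h1 | h1
  · by_contra h2
    have h3 : 3 ≤ r := by lia
    obtain ⟨i, j, l, hij, hil, hjl⟩ : ∃ i j l : Fin r, i ≠ j ∧ i ≠ l ∧ j ≠ l :=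
      ⟨⟨0, by lia⟩, ⟨1, by lia⟩, ⟨2, by lia⟩, by simp, by simp, by simp⟩
    -- Degrees -1, -2, -3 contribute at least 3 + 3 + 2 = 8, more than half of 14.
    have d1 := card_le_finrank (f := (Φ : FreeNilpotent ℂ r 3 →ₗ[ℂ] LieAlgebra.g₂ ℂ)) hΦ
      (linearIndependent_one hij hil hjl) (D := freeNilpotentDegree ℂ r 3 1) (by
        intro m; fin_cases m <;> exact Submodule.subset_span ⟨_, rfl⟩)
    have d2 := card_le_finrank (f := (Φ : FreeNilpotent ℂ r 3 →ₗ[ℂ] LieAlgebra.g₂ ℂ)) hΦ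
      (linearIndependent_two hij hil hjl) (D := freeNilpotentDegree ℂ r 3 2) (by
        intro m; fin_cases m <;> exact freeNilpotentDegree_two_mem _ _)
    have d3 := card_le_finrank (f := (Φ : FreeNilpotent ℂ r 3 →ₗ[ℂ] LieAlgebra.g₂ ℂ)) hΦ
      (linearIndependent_three hij) (D := freeNilpotentDegree ℂ r 3 3) (by
        intro m; fin_cases m <;> exact freeNilpotentDegree_three_mem _ _ _)
    have m1 : 𝔫 (-1) = _ := hmap 0
    have m2 : 𝔫 (-2) = _ := hmap 1
    have m3 : 𝔫 (-3) = _ := hmap 2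
    have hle := two_mul_finrank_le h
    rw [m1, m2, m3] at hle
    simp only [Nat.reduceAdd] at hle
    omega
  · exfalso
    apply h.ne_bot
    have m3 : 𝔫 (-((3 : ℕ) : ℤ)) = _ := hmap 2
    rw [m3, freeNilpotentDegree_eq_bot h1 1, Submodule.map_bot]

theorem exists_isFreePair (h : IsKGrading 3 𝔫)
    (hiso : GradedIsomorphic (freeNilpotentGrading ℂ 2 3) (negativeGrading h)) :
    ∃ v w, IsFreePair 𝔫 v w := by
  obtain ⟨Φ, hΦ, hmap⟩ := exists_embedding_of_gradedIsomorphic h hiso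
  have m1 : 𝔫 (-1) = _ := hmap 0
  have m2 : 𝔫 (-2) = _ := hmap 1
  have m3 : 𝔫 (-3) = _ := hmap 2
  rw [freeNilpotentDegree_one_two, Submodule.map_span, Set.image_pair] at m1
  rw [freeNilpotentDegree_two_two, Submodule.map_span, Set.image_singleton] at m2
  rw [freeNilpotentDegree_three_two, Submodule.map_span, Set.image_pair] at m3
  have hind := linearIndependent_basicBrackets_free.map'
    (Φ : FreeNilpotent ℂ 2 3 →ₗ[ℂ] LieAlgebra.g₂ ℂ) (LinearMap.ker_eq_bot_of_injective hΦ)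
  set x := freeNilpotentGen ℂ 2 3 0
  set y := freeNilpotentGen ℂ 2 3 1
  have hcomp : (Φ : FreeNilpotent ℂ 2 3 →ₗ[ℂ] LieAlgebra.g₂ ℂ) ∘ basicBrackets x y =
      basicBrackets (Φ x) (Φ y) := funext (map_basicBrackets Φ x y)
  rw [hcomp] at hind
  refine ⟨Φ x, Φ y, h, m1, ?_, ?_, ?_, hind.ne_zero 2, ?_⟩
  · rw [m2]; simp
  · rw [m3]; simp
  · have e : ![Φ x, Φ y] = basicBrackets (Φ x) (Φ y) ∘ ![0, 1] := by
      ext1 i; fin_cases i <;> rfl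
    rw [e]
    exact hind.comp _ (by decide)
  · have e : ![⁅Φ x, ⁅Φ x, Φ y⁆⁆, ⁅Φ y, ⁅Φ x, Φ y⁆⁆] = basicBrackets (Φ x) (Φ y) ∘ ![3, 4] := by
      ext1 i; fin_cases i <;> rfl
    rw [e]
    exact hind.comp _ (by decide)

end Rank

end

end LieGrading

theorem mainTheorem9 :
    (∀ (𝔫 : ℤ → Submodule ℂ (LieAlgebra.g₂ ℂ)) (h : LieGrading.IsKGrading 3 𝔫) (r : ℕ),
      LieGrading.GradedIsomorphic (LieGrading.freeNilpotentGrading ℂ r 3)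
          (LieGrading.negativeGrading h) →
        2 * (r : ℤ) ^ 3 + 3 * (r : ℤ) ^ 2 + (r : ℤ) - 30 = 0 ∧
        r = 2 ∧
        LieGrading.GradedIsomorphic 𝔫 LieGrading.cartanGrading) ∧
    ∃ h : LieGrading.IsKGrading 3 LieGrading.cartanGrading,
      LieGrading.GradedIsomorphic (LieGrading.freeNilpotentGrading ℂ 2 3)
        (LieGrading.negativeGrading h) := by
  refine ⟨fun 𝔫 h r hiso => ?_, LieGrading.isKGrading_cartanGrading,
    LieGrading.gradedIsomorphic_cartanGrading⟩
  obtain rfl := LieGrading.rank_eq_two h hiso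
  obtain ⟨v, w, hvw⟩ := LieGrading.exists_isFreePair h hiso
  -- The cubic says that the dimension (2r³ + 3r² + r)/6 of 𝔉_{r,3} is 5; here it is only evaluated
  -- at r = 2.
  exact ⟨by norm_num, rfl, hvw.gradedIsomorphic⟩
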